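/- For $\beta>0$ let $w_\beta(x)=\exp(-x^\beta)$ on $(0,\infty)$, $\mu_n=\int_0^\infty x^n w_\beta(x)\,dx$ for $n\ge 0$, and let $\lambda_N$ be the smallest eigenvalue of the Hankel matrix $(\mu_{j+k})_{0\le j,k\le N}$. By the smallest eigenvalue of the infinite Hankel matrix $(\mu_{j+k})_{j,k\ge 0}$ we mean the lower bound of its quadratic form, $$\inf\Big\{\frac{\sum_{j,k}\mu_{j+k}x_j\overline{x_k}}{\sum_j|x_j|^2}\;:\; x\ne 0 \text{ a finitely supported complex sequence}\Big\}.$$ Let $P_n$ be the polynomials of degree $n$ with positive leading coefficient that are orthonormal with respect to $w_\beta$ on $(0,\infty)$, and let $K_{jk}=\int_0^{2\pi}P_j(e^{i\varphi})\overline{P_k(e^{i\varphi})}\,d\varphi$. The moment problem for $(\mu_n)$ on $S\subseteq\mathbb R$ asks for the Borel measures on $\mathbb R$, carried by $S$, with moments $\mu_n$, $n\ge0$; it is determinate if there is exactly one such measure and indeterminate if there are at least two. (a) Let $\beta>1/2$. Then the moment problem for $(\mu_n)$ is determinate, both on $[0,\infty)$ (Stieltjes) and on $\mathbb R$ (Hamburger);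 $\lim_{N\to\infty}\lambda_N=0$; the smallest eigenvalue of the infinite Hankel matrix is $0$; and the series $\sum_{j\ge 0}K_{jj}$ diverges. (b) Let $0<\beta<1/2$. Then the moment problem for $(\mu_n)$ is indeterminate, both on $[0,\infty)$ and on $\mathbb R$; the series $\sum_{j\ge 0}|P_j(z)|^2$ converges for every $z\in\mathbb C$, locally uniformly on $\mathbb C$; the series $\sum_{j\ge 0}K_{jj}$ converges to a real number $\xi>0$; $\lambda_N\ge 2\pi/\xi$ for all $N\ge 0$; and $\lambda_N$ converges, as $N\to\infty$, to the smallest eigenvalue of the infinite Hankel matrix, which is therefore at least $2\pi/\xi>0$. -/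

import Mathlib

open Polynomial

namespace HankelTransition

noncomputable section

/-- The weight `w(x) = exp(-x^β)`; it is only used for `x > 0`. -/
def weight (β x : ℝ) : ℝ := Real.exp (-x ^ β)

/-- The moments `μ_n = ∫_0^∞ x^n exp(-x^β) dx`. -/
def moment (β : ℝ) (n : ℕ) : ℝ := ∫ x in Set.Ioi (0 : ℝ), x ^ n * weight β x

/-- `ν` is a solution, carried by `S`, of the moment problem with moment sequence `s`. -/
def IsMomentSolution (S : Set ℝ) (s : ℕ → ℝ) (ν : MeasureTheory.Measure ℝ) : Prop :=
  ν Sᶜ = 0 ∧ ∀ n : ℕ, MeasureTheory.Integrable (fun x : ℝ => x ^ n) ν ∧ ∫ x, x ^ n ∂ν = s n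

/-- The moment problem for `s` on `S` has exactly one solution. The Stieltjes problem is
`S = Set.Ici 0`, the Hamburger problem is `S = Set.univ`. -/
def MomentDeterminate (S : Set ℝ) (s : ℕ → ℝ) : Prop :=
  ∃! ν : MeasureTheory.Measure ℝ, IsMomentSolution S s ν

/-- The moment problem for `s` on `S` has more than one solution. -/
def MomentIndeterminate (S : Set ℝ) (s : ℕ → ℝ) : Prop :=
  ∃ ν₁ ν₂ : MeasureTheory.Measure ℝ,
    IsMomentSolution S s ν₁ ∧ IsMomentSolution S s ν₂ ∧ ν₁ ≠ ν₂

/-- The Hankel matrix `H_{jk} = μ_{j+k}`, `0 ≤ j, k ≤ N`. -/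
def hankel (β : ℝ) (N : ℕ) : Matrix (Fin (N + 1)) (Fin (N + 1)) ℝ :=
  Matrix.of fun j k => moment β ((j : ℕ) + (k : ℕ))

theorem hankel_isHermitian (β : ℝ) (N : ℕ) : (hankel β N).IsHermitian := by
  ext j k
  simp [hankel, Matrix.conjTranspose_apply, add_comm]

/-- The smallest eigenvalue `λ_N` of the Hankel matrix of order `N + 1`. -/
def smallestEigenvalue (β : ℝ) (N : ℕ) : ℝ :=
  ⨅ i : Fin (N + 1), (hankel_isHermitian β N).eigenvalues i

/-- The values of the Rayleigh quotient `∑ H_{jk} x_j conj(x_k) / ∑ |x_j|^2` of the infinite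
Hankel matrix `(μ_{j+k})_{j,k ≥ 0}` at the nonzero finitely supported complex sequences `x`. -/
def infiniteRayleigh (β : ℝ) : Set ℝ :=
  {r | ∃ x : ℕ →₀ ℂ, x ≠ 0 ∧
    r = (∑ j ∈ x.support, ∑ k ∈ x.support,
          (moment β (j + k) : ℂ) * x j * (starRingEnd ℂ) (x k)).re /
        ∑ j ∈ x.support, ‖x j‖ ^ 2}

/-- The smallest eigenvalue of the infinite Hankel matrix is `m`: the lower bound of its quadratic
form, the infimum of its Rayleigh quotients, is `m`. -/
def IsSmallestEigenvalueInfinite (β m : ℝ) : Prop := IsGLB (infiniteRayleigh β) m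

/-- The inner product `∫_0^∞ p(x) q(x) exp(-x^β) dx`. -/
def inner (β : ℝ) (p q : ℝ[X]) : ℝ :=
  ∫ x in Set.Ioi (0 : ℝ), p.eval x * q.eval x * weight β x

/-- The monic orthogonal polynomials for the weight, by the Gram-Schmidt process applied to
`1, X, X^2, …`. -/
def monicOrthogonal (β : ℝ) : ℕ → ℝ[X]
  | n => X ^ n - ∑ k : Fin n,
      C (inner β (X ^ n) (monicOrthogonal β k) /
          inner β (monicOrthogonal β k) (monicOrthogonal β k)) * monicOrthogonal β k
termination_by n => n
decreasing_by all_goals exact k.isLt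

/-- The orthonormal polynomials `P_n` for the weight (with positive leading coefficients). -/
def orthonormalPoly (β : ℝ) (n : ℕ) : ℝ[X] :=
  C (1 / Real.sqrt (inner β (monicOrthogonal β n) (monicOrthogonal β n))) * monicOrthogonal β n

/-- The value `P_n(z)` at a complex number `z`. -/
def orthonormalEval (β : ℝ) (n : ℕ) (z : ℂ) : ℂ := aeval z (orthonormalPoly β n)

/-- `K_{jk} = ∫_0^{2π} P_j(e^{iφ}) conj(P_k(e^{iφ})) dφ`. -/
def circleKernel (β : ℝ) (j k : ℕ) : ℂ :=
  ∫ φ in (0 : ℝ)..(2 * Real.pi),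
    orthonormalEval β j (Complex.exp (φ * Complex.I)) *
      (starRingEnd ℂ) (orthonormalEval β k (Complex.exp (φ * Complex.I)))

end

end HankelTransition

/-!
The weight `exp(-x^β)` on `(0, ∞)` changes its behaviour at `β = 1/2` because the decisive fact is
whether point evaluations `p ↦ p(z)` are bounded on polynomials in the norm of `L²(w_β)`.

The coefficients of a polynomial of degree at most `N`, in the monomial and in the orthonormal
basis, give `λ_N` as a minimum of `∫ p² w / ∑ p_k²` (`smallestEigenvalue_mul_le`,
`exists_inner_self_eq_smallestEigenvalue_mul`), so that `λ_N` decreases to the lower bound of the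
infinite form. Parseval's identity on the unit circle gives `K_jj = 2π ∑_k b_jk²` for
`P_j = ∑_k b_jk X^k`, and Cauchy–Schwarz then yields `1 ≤ λ_N ∑_{j ≤ N} K_jj / 2π`
(`one_le_smallestEigenvalue_mul`).

For `β > 1/2` evaluations off `[0, ∞)` are unbounded. With `Re b > 0` the function
`exp(-bS) (cos(S√x) - (√x/b) sin(S√x))` is entire in `x`, equals `1` at `x = -b²`, and is at most
`exp(-S Re b) (1 + √x/|b|)` on `(0, ∞)`, hence small in `L²(w_β)` for large `S`. Its Taylor
polynomials are dominated by the exponential of a multiple of `√x`, which lies in `L²(w_β)`, so they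
converge to it there (`exists_eval_eq_one_integral_lt`). Taking `-b²` in the unit disc, this forces
`λ_N → 0` and therefore the divergence of `∑ K_jj`. Taking `w = -b²` nonreal, it shows that
`1/(x - w)` is an `L²`-limit of polynomials for every measure on `ℝ` with the moments of `w_β`; the
multipliers of the closure of the polynomials then form a star algebra of bounded continuous
functions that separates points, and the moments determine the integrals of its elements
(`eq_of_moments_eq`). The Stieltjes problem is contained in the Hamburger problem.

For `0 < β < 1/2` the function `sin(tan(πβ) x^β)` is orthogonal to all polynomials, by the Gamma
integral along the ray where `1 - i tan(πβ)` lies, which gives a second solution on `[0, ∞)`.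
Evaluations are bounded, locally uniformly on `ℂ`: if `Q' = p²` and `Q(0) = 0`, then
`|Q(x)| ≤ ‖p‖² exp(x^β)` for `x ≥ 0`; the Phragmén–Lindelöf principle in the slit plane, applied to
`Q(z) exp(-A (-z)^β)` with `A cos(πβ) = 1`, gives `|Q(z)| ≤ ‖p‖² exp(A |z|^β)`, and Cauchy's
estimate returns to `p² = Q'` (`sq_norm_aeval_le`). By duality `∑_j |P_j(z)|²` is bounded on discs;
integrating over circles bounds the series of the squared coefficients, which serves as a majorant
for the uniform convergence and sums the `K_jj`.
-/

namespace HankelTransition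

open MeasureTheory Set

open scoped BoundedContinuousFunction

/-! ### The weight as a measure and the moment functional -/

/-- The measure `exp(-x^β) dx` on `(0, ∞)`. -/
noncomputable def weightMeasure (β : ℝ) : Measure ℝ :=
  (volume.restrict (Ioi 0)).withDensity fun x => ENNReal.ofReal (weight β x)

theorem weight_pos (β x : ℝ) : 0 < weight β x := Real.exp_pos _

@[fun_prop]
theorem measurable_weight (β : ℝ) : Measurable (weight β) := by
  unfold weight; fun_prop

theorem integral_weightMeasure {E : Type*} [NormedAddCommGroup E] [NormedSpace ℝ E]
    (β : ℝ) (f : ℝ → E) :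
    ∫ x, f x ∂weightMeasure β = ∫ x in Ioi (0 : ℝ), weight β x • f x := by
  rw [weightMeasure, integral_withDensity_eq_integral_toReal_smul (by fun_prop) (by simp)]
  simp [(weight_pos β _).le]

theorem integrable_weightMeasure_iff {E : Type*} [NormedAddCommGroup E] [NormedSpace ℝ E]
    {β : ℝ} {f : ℝ → E} :
    Integrable f (weightMeasure β) ↔ IntegrableOn (fun x => weight β x • f x) (Ioi 0) := by
  rw [weightMeasure, integrable_withDensity_iff_integrable_smul' (by fun_prop) (by simp)]
  simp [(weight_pos β _).le, IntegrableOn]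

theorem ae_weightMeasure_pos (β : ℝ) : ∀ᵐ x ∂weightMeasure β, 0 < x :=
  (withDensity_absolutelyContinuous _ _).ae_le (ae_restrict_mem measurableSet_Ioi)

theorem integrableOn_rpow_mul_weight {β q : ℝ} (hβ : 0 < β) (hq : -1 < q) :
    IntegrableOn (fun x : ℝ => x ^ q * weight β x) (Ioi 0) := by
  apply Integrable.of_integral_ne_zero
  unfold weight
  rw [integral_rpow_mul_exp_neg_rpow hβ hq]
  have : 0 < Real.Gamma ((q + 1) / β) := Real.Gamma_pos_of_pos (by apply div_pos <;> linarith)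
  positivity

theorem integrable_pow_weightMeasure {β : ℝ} (hβ : 0 < β) (n : ℕ) :
    Integrable (fun x : ℝ => x ^ n) (weightMeasure β) := by
  rw [integrable_weightMeasure_iff]
  have := integrableOn_rpow_mul_weight hβ (q := n) (by have := n.cast_nonneg (α := ℝ); linarith)
  simpa [mul_comm] using this

theorem integral_pow_weightMeasure (β : ℝ) (n : ℕ) :
    ∫ x, x ^ n ∂weightMeasure β = moment β n := by
  simp [integral_weightMeasure, moment, mul_comm]

theorem isFiniteMeasure_of_integrable_pow {ν : Measure ℝ}
    (h : ∀ n : ℕ, Integrable (fun x : ℝ => x ^ n) ν) : IsFiniteMeasure ν := by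
  have := h 0
  simp only [pow_zero] at this
  simpa [integrable_const_iff] using this

theorem integrable_eval {ν : Measure ℝ} (h : ∀ n : ℕ, Integrable (fun x : ℝ => x ^ n) ν)
    (p : ℝ[X]) : Integrable (fun x => p.eval x) ν := by
  simp only [eval_eq_sum_range]
  exact integrable_finsetSum _ fun n _ => (h n).const_mul _

/-- The moment functional `p ↦ ∫ p dν` on real polynomials. -/
noncomputable def momentFunctional {ν : Measure ℝ}
    (h : ∀ n : ℕ, Integrable (fun x : ℝ => x ^ n) ν) : ℝ[X] →ₗ[ℝ] ℝ where
  toFun p := ∫ x, p.eval x ∂ν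
  map_add' p q := by
    simp only [eval_add]
    exact integral_add (integrable_eval h p) (integrable_eval h q)
  map_smul' c p := by
    simp only [eval_smul, smul_eq_mul, RingHom.id_apply, integral_const_mul]

/-- The integral of a polynomial only depends on the moments of the measure. -/
theorem integral_eval_congr {ν ν' : Measure ℝ} (h : ∀ n : ℕ, Integrable (fun x : ℝ => x ^ n) ν)
    (h' : ∀ n : ℕ, Integrable (fun x : ℝ => x ^ n) ν')
    (heq : ∀ n : ℕ, ∫ x, x ^ n ∂ν = ∫ x, x ^ n ∂ν') (p : ℝ[X]) :
    ∫ x, p.eval x ∂ν = ∫ x, p.eval x ∂ν' := by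
  have : momentFunctional h = momentFunctional h' := by
    ext n
    simpa [momentFunctional] using heq n
  exact LinearMap.congr_fun this p

theorem inner_eq_integral (β : ℝ) (p q : ℝ[X]) :
    inner β p q = ∫ x, (p * q).eval x ∂weightMeasure β := by
  simp only [inner, integral_weightMeasure, eval_mul, smul_eq_mul]
  congr 1; ext x; ring

theorem inner_eq_momentFunctional {β : ℝ} (hβ : 0 < β) (p q : ℝ[X]) :
    inner β p q = momentFunctional (integrable_pow_weightMeasure hβ) (p * q) :=
  inner_eq_integral β p q

theorem inner_comm (β : ℝ) (p q : ℝ[X]) : inner β p q = inner β q p := by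
  rw [inner_eq_integral, inner_eq_integral, mul_comm]

theorem inner_self_pos {β : ℝ} (hβ : 0 < β) {p : ℝ[X]} (hp : p ≠ 0) : 0 < inner β p p := by
  have hint := integrable_weightMeasure_iff.1
    (integrable_eval (integrable_pow_weightMeasure hβ) (p * p))
  rw [inner_eq_integral, integral_weightMeasure]
  have hnn : ∀ x, 0 ≤ weight β x • (p * p).eval x := fun x => by
    rw [eval_mul]; exact mul_nonneg (weight_pos β x).le (mul_self_nonneg _)
  refine lt_of_le_of_ne (integral_nonneg hnn) fun h0 => ?_
  have h1 := (integral_eq_zero_iff_of_nonneg hnn hint).1 h0.symm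
  have h2 : ∀ᵐ x ∂(volume.restrict (Ioi (0 : ℝ))), p.eval x = 0 := by
    filter_upwards [h1] with x hx
    have := (weight_pos β x).ne'
    simpa [this] using hx
  have h3 : ∀ᵐ x ∂(volume.restrict (Ioi (0 : ℝ))), p.eval x ≠ 0 := by
    apply ae_restrict_of_ae
    have hfin : {x | p.eval x = 0}.Finite := by
      refine p.roots.toFinset.finite_toSet.subset fun x hx => ?_
      simpa [hp] using hx
    simpa [ae_iff] using hfin.measure_zero volume
  have h4 : ∀ᵐ x ∂(volume.restrict (Ioi (0 : ℝ))), False := by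
    filter_upwards [h2, h3] with x hx hx' using hx' hx
  have h5 := ae_iff.1 h4
  simp at h5

theorem inner_self_nonneg (β : ℝ) (p : ℝ[X]) : 0 ≤ inner β p p := by
  rw [inner_eq_integral]
  exact integral_nonneg fun x => by rw [eval_mul]; exact mul_self_nonneg _

theorem inner_sub_left {β : ℝ} (hβ : 0 < β) (p q r : ℝ[X]) :
    inner β (p - q) r = inner β p r - inner β q r := by
  simp only [inner_eq_momentFunctional hβ, sub_mul, map_sub]

theorem inner_sum_left {β : ℝ} (hβ : 0 < β) {ι : Type*} (s : Finset ι) (f : ι → ℝ[X])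
    (r : ℝ[X]) : inner β (∑ i ∈ s, f i) r = ∑ i ∈ s, inner β (f i) r := by
  simp only [inner_eq_momentFunctional hβ, Finset.sum_mul, map_sum]

theorem inner_C_mul_left (β c : ℝ) (p r : ℝ[X]) :
    inner β (C c * p) r = c * inner β p r := by
  simp only [inner_eq_integral, mul_assoc, eval_C_mul, integral_const_mul]

theorem inner_C_mul_right (β c : ℝ) (p r : ℝ[X]) :
    inner β p (C c * r) = c * inner β p r := by
  rw [inner_comm, inner_C_mul_left, inner_comm]

/-! ### Orthonormal polynomials -/

theorem monicOrthogonal_eq (β : ℝ) (n : ℕ) : monicOrthogonal β n =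
    X ^ n - ∑ k : Fin n, C (inner β (X ^ n) (monicOrthogonal β k) /
      inner β (monicOrthogonal β k) (monicOrthogonal β k)) * monicOrthogonal β k := by
  rw [monicOrthogonal]

theorem natDegree_monicOrthogonal_le (β : ℝ) (n : ℕ) : (monicOrthogonal β n).natDegree ≤ n := by
  induction n using Nat.strong_induction_on with
  | _ n ih =>
    rw [monicOrthogonal_eq]
    refine (natDegree_sub_le _ _).trans (max_le (natDegree_X_pow_le n) ?_)
    refine natDegree_sum_le_of_forall_le _ _ fun k _ => ?_
    exact (natDegree_C_mul_le _ _).trans ((ih k k.2).trans k.2.le)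

theorem coeff_monicOrthogonal_self (β : ℝ) (n : ℕ) : (monicOrthogonal β n).coeff n = 1 := by
  rw [monicOrthogonal_eq, coeff_sub, coeff_X_pow_self, finsetSum_coeff, Finset.sum_eq_zero,
    sub_zero]
  intro k _
  rw [coeff_C_mul, coeff_eq_zero_of_natDegree_lt
    ((natDegree_monicOrthogonal_le β k).trans_lt k.2), mul_zero]

theorem monicOrthogonal_ne_zero (β : ℝ) (n : ℕ) : monicOrthogonal β n ≠ 0 := fun h => by
  simpa [h] using coeff_monicOrthogonal_self β n

theorem inner_monicOrthogonal_of_lt {β : ℝ} (hβ : 0 < β) (n : ℕ) :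
    ∀ m < n, inner β (monicOrthogonal β n) (monicOrthogonal β m) = 0 := by
  induction n using Nat.strong_induction_on with
  | _ n ih =>
    intro m hm
    have hpos := inner_self_pos hβ (monicOrthogonal_ne_zero β m)
    rw [monicOrthogonal_eq β n, inner_sub_left hβ, inner_sum_left hβ,
      Finset.sum_eq_single (⟨m, hm⟩ : Fin n)]
    · rw [inner_C_mul_left]
      field_simp
      simp
    · intro k _ hk
      have hkm : (k : ℕ) ≠ m := fun h => hk (Fin.ext h)
      rw [inner_C_mul_left]
      rcases lt_or_gt_of_ne hkm with h | h
      · rw [inner_comm β (monicOrthogonal β k) (monicOrthogonal β m), ih m hm k h, mul_zero]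
      · rw [ih k k.2 m h, mul_zero]
    · simp

theorem inner_orthonormalPoly {β : ℝ} (hβ : 0 < β) (i j : ℕ) :
    inner β (orthonormalPoly β i) (orthonormalPoly β j) = if i = j then 1 else 0 := by
  rw [orthonormalPoly, orthonormalPoly, inner_C_mul_left, inner_C_mul_right]
  split_ifs with h
  · subst h
    have hpos := inner_self_pos hβ (monicOrthogonal_ne_zero β i)
    have hsq := Real.mul_self_sqrt hpos.le
    have := (Real.sqrt_pos.2 hpos).ne'
    field_simp
    rw [sq, hsq]
  · rcases lt_or_gt_of_ne h with h | h
    · rw [inner_comm β (monicOrthogonal β i) (monicOrthogonal β j),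
        inner_monicOrthogonal_of_lt hβ j i h]; simp
    · rw [inner_monicOrthogonal_of_lt hβ i j h]; simp

theorem natDegree_orthonormalPoly_le (β : ℝ) (n : ℕ) : (orthonormalPoly β n).natDegree ≤ n :=
  (natDegree_C_mul_le _ _).trans (natDegree_monicOrthogonal_le β n)

theorem orthonormalPoly_ne_zero {β : ℝ} (hβ : 0 < β) (n : ℕ) : orthonormalPoly β n ≠ 0 := by
  intro h
  have := inner_orthonormalPoly hβ n n
  simp [h, inner] at this

/-- The Gram–Schmidt recursion, read backwards, expresses `X^n` through the first `n + 1` orthogonal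
polynomials. -/
theorem exists_sum_orthonormalPoly {β : ℝ} (hβ : 0 < β) {N : ℕ} {p : ℝ[X]}
    (hp : p.natDegree ≤ N) :
    ∃ c : ℕ → ℝ, p = ∑ j ∈ Finset.range (N + 1), C (c j) * orthonormalPoly β j := by
  classical
  set V := Submodule.span ℝ (orthonormalPoly β '' (Finset.range (N + 1) : Set ℕ)) with hV
  have hM : ∀ k ≤ N, monicOrthogonal β k ∈ V := fun k hk => by
    have h1 : orthonormalPoly β k ∈ V :=
      Submodule.subset_span ⟨k, by simpa using Nat.lt_succ_of_le hk, rfl⟩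
    have hpos := inner_self_pos hβ (monicOrthogonal_ne_zero β k)
    have h2 : monicOrthogonal β k =
        Real.sqrt (inner β (monicOrthogonal β k) (monicOrthogonal β k)) • orthonormalPoly β k := by
      rw [orthonormalPoly, smul_eq_C_mul, ← mul_assoc, ← C_mul,
        mul_one_div_cancel (Real.sqrt_pos.2 hpos).ne', C_1, one_mul]
    rw [h2]
    exact V.smul_mem _ h1
  have hX : ∀ n ≤ N, (X ^ n : ℝ[X]) ∈ V := fun n hn => by
    have h := monicOrthogonal_eq β n
    rw [eq_sub_iff_add_eq] at h
    rw [← h]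
    refine V.add_mem (hM n hn) (V.sum_mem fun k _ => ?_)
    rw [← smul_eq_C_mul]
    exact V.smul_mem _ (hM k (k.2.le.trans hn))
  have hpV : p ∈ V := by
    rw [p.as_sum_range_C_mul_X_pow]
    refine V.sum_mem fun n hn => ?_
    rw [← smul_eq_C_mul]
    exact V.smul_mem _ (hX n (by have := Finset.mem_range.1 hn; omega))
  rw [hV, Submodule.mem_span_image_finset_iff_exists_fun'] at hpV
  obtain ⟨c, hc⟩ := hpV
  exact ⟨c, by simp only [← hc, smul_eq_C_mul]⟩

theorem inner_sum_orthonormalPoly {β : ℝ} (hβ : 0 < β) (s : Finset ℕ) (c : ℕ → ℝ) :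
    inner β (∑ j ∈ s, C (c j) * orthonormalPoly β j) (∑ j ∈ s, C (c j) * orthonormalPoly β j) =
      ∑ j ∈ s, c j ^ 2 := by
  rw [inner_sum_left hβ]
  refine Finset.sum_congr rfl fun i hi => ?_
  rw [inner_comm, inner_sum_left hβ]
  simp only [inner_C_mul_left, inner_C_mul_right, inner_orthonormalPoly hβ]
  simp [hi, sq]

/-! ### The smallest eigenvalue as a minimum over real polynomials -/

/-- Rayleigh's bound: a Hermitian matrix is at least its smallest eigenvalue. -/
theorem iInf_eigenvalues_mul_le {n : Type*} [Fintype n] [DecidableEq n] {A : Matrix n n ℝ}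
    (hA : A.IsHermitian) (x : n → ℝ) :
    (⨅ i, hA.eigenvalues i) * (x ⬝ᵥ x) ≤ x ⬝ᵥ A.mulVec x := by
  set m := ⨅ i, hA.eigenvalues i with hm
  have hD : (Matrix.diagonal fun i => hA.eigenvalues i - m).PosSemidef :=
    Matrix.PosSemidef.diagonal fun i => sub_nonneg.2 (ciInf_le (Finite.bddBelow_range _) i)
  have hU := hD.mul_mul_conjTranspose_same (hA.eigenvectorUnitary : Matrix n n ℝ)
  have hA' : A - m • (1 : Matrix n n ℝ) = (hA.eigenvectorUnitary : Matrix n n ℝ) *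
      (Matrix.diagonal fun i => hA.eigenvalues i - m) *
      (hA.eigenvectorUnitary : Matrix n n ℝ).conjTranspose := by
    have h1 : (Matrix.diagonal fun i => hA.eigenvalues i - m) =
        Matrix.diagonal (RCLike.ofReal ∘ hA.eigenvalues) - m • (1 : Matrix n n ℝ) := by
      rw [Matrix.smul_one_eq_diagonal, Matrix.diagonal_sub]
      rfl
    have h2 := Unitary.conjStarAlgAut_apply (S := ℝ) hA.eigenvectorUnitary
      (Matrix.diagonal fun i => hA.eigenvalues i - m)
    rw [← Matrix.star_eq_conjTranspose, ← h2, h1, map_sub, ← hA.spectral_theorem, map_smul,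
      map_one]
  rw [← hA'] at hU
  have := hU.re_dotProduct_nonneg x
  simp only [star_trivial, RCLike.re_to_real, Matrix.sub_mulVec, Matrix.smul_mulVec,
    Matrix.one_mulVec, dotProduct_sub, dotProduct_smul, smul_eq_mul] at this
  linarith

/-- The sum of the squares of the coefficients of a polynomial. -/
noncomputable def coeffNormSq (p : ℝ[X]) : ℝ := ∑ k ∈ p.support, p.coeff k ^ 2

theorem coeffNormSq_eq_sum {p : ℝ[X]} {s : Finset ℕ} (hs : p.support ⊆ s) :
    coeffNormSq p = ∑ k ∈ s, p.coeff k ^ 2 := by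
  refine Finset.sum_subset hs fun k _ hk => ?_
  rw [notMem_support_iff.1 hk]; simp

theorem coeffNormSq_eq_sum_range {p : ℝ[X]} {N : ℕ} (hp : p.natDegree ≤ N) :
    coeffNormSq p = ∑ k ∈ Finset.range (N + 1), p.coeff k ^ 2 :=
  coeffNormSq_eq_sum (supp_subset_range (Nat.lt_succ_of_le hp))

theorem coeffNormSq_nonneg (p : ℝ[X]) : 0 ≤ coeffNormSq p := by
  unfold coeffNormSq; positivity

theorem coeffNormSq_pos {p : ℝ[X]} (hp : p ≠ 0) : 0 < coeffNormSq p := by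
  refine Finset.sum_pos (fun k hk => ?_) (support_nonempty.2 hp)
  have := mem_support_iff.1 hk
  positivity

theorem inner_self_eq_sum {β : ℝ} (hβ : 0 < β) (s : Finset ℕ) (a : ℕ → ℝ) :
    inner β (∑ k ∈ s, C (a k) * X ^ k) (∑ k ∈ s, C (a k) * X ^ k) =
      ∑ j ∈ s, ∑ k ∈ s, moment β (j + k) * a j * a k := by
  rw [inner_sum_left hβ]
  refine Finset.sum_congr rfl fun i _ => ?_
  rw [inner_comm, inner_sum_left hβ]
  refine Finset.sum_congr rfl fun k _ => ?_
  rw [inner_C_mul_left, inner_C_mul_right, inner_eq_integral, ← pow_add]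
  simp only [eval_pow, eval_X]
  rw [integral_pow_weightMeasure, add_comm k i]
  ring

theorem inner_self_eq_hankel {β : ℝ} (hβ : 0 < β) {N : ℕ} {p : ℝ[X]} (hp : p.natDegree ≤ N) :
    inner β p p = (fun i : Fin (N + 1) => p.coeff i) ⬝ᵥ
      (hankel β N).mulVec (fun i : Fin (N + 1) => p.coeff i) := by
  have h := inner_self_eq_sum hβ (Finset.range (N + 1)) p.coeff
  rw [← p.as_sum_range_C_mul_X_pow' (Nat.lt_succ_of_le hp)] at h
  rw [h, Finset.sum_range]
  simp only [dotProduct, Matrix.mulVec, hankel, Matrix.of_apply]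
  refine Finset.sum_congr rfl fun i _ => ?_
  rw [Finset.sum_range, Finset.mul_sum]
  exact Finset.sum_congr rfl fun k _ => by ring

theorem smallestEigenvalue_mul_le {β : ℝ} (hβ : 0 < β) {N : ℕ} {p : ℝ[X]}
    (hp : p.natDegree ≤ N) : smallestEigenvalue β N * coeffNormSq p ≤ inner β p p := by
  have h := iInf_eigenvalues_mul_le (hankel_isHermitian β N) fun i : Fin (N + 1) => p.coeff i
  rw [← inner_self_eq_hankel hβ hp] at h
  rw [coeffNormSq_eq_sum_range hp, Finset.sum_range]
  simpa only [dotProduct, sq, smallestEigenvalue] using h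

/-- The minimum is attained by the polynomial whose coefficients form an eigenvector. -/
theorem exists_inner_self_eq_smallestEigenvalue_mul {β : ℝ} (hβ : 0 < β) (N : ℕ) :
    ∃ p : ℝ[X], p ≠ 0 ∧ p.natDegree ≤ N ∧
      inner β p p = smallestEigenvalue β N * coeffNormSq p := by
  obtain ⟨i, hi⟩ := exists_eq_ciInf_of_finite (f := (hankel_isHermitian β N).eigenvalues)
  set v : Fin (N + 1) → ℝ := ⇑((hankel_isHermitian β N).eigenvectorBasis i) with hv
  have hev : (hankel β N).mulVec v = smallestEigenvalue β N • v := by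
    rw [smallestEigenvalue, ← hi]
    exact (hankel_isHermitian β N).mulVec_eigenvectorBasis i
  have hv0 : v ≠ 0 := by
    intro h
    refine ((hankel_isHermitian β N).eigenvectorBasis.orthonormal.ne_zero i) ?_
    ext k
    exact congrFun h k
  have hcoeff : (fun k : Fin (N + 1) => (ofFn (N + 1) v).coeff k) = v := by
    ext k
    rw [ofFn_coeff_eq_val_of_lt _ k.2]
  have hdeg : (ofFn (N + 1) v).natDegree ≤ N := Nat.lt_succ_iff.1 (ofFn_natDegree_lt (by omega) v)
  refine ⟨ofFn (N + 1) v, ?_, hdeg, ?_⟩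
  · intro h
    apply hv0
    rw [← hcoeff, h]
    ext k; simp
  · rw [inner_self_eq_hankel hβ hdeg, coeffNormSq_eq_sum_range hdeg, Finset.sum_range, hcoeff, hev,
      dotProduct_smul, smul_eq_mul]
    congr 1
    rw [dotProduct]
    refine Finset.sum_congr rfl fun k _ => ?_
    rw [← congrFun hcoeff k, sq]

theorem smallestEigenvalue_pos {β : ℝ} (hβ : 0 < β) (N : ℕ) : 0 < smallestEigenvalue β N := by
  obtain ⟨p, hp0, _, hp⟩ := exists_inner_self_eq_smallestEigenvalue_mul hβ N
  have h1 := inner_self_pos hβ hp0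
  rw [hp] at h1
  exact pos_of_mul_pos_left h1 (coeffNormSq_nonneg p)

theorem antitone_smallestEigenvalue {β : ℝ} (hβ : 0 < β) : Antitone (smallestEigenvalue β) := by
  intro M N hMN
  obtain ⟨p, hp0, hdeg, hp⟩ := exists_inner_self_eq_smallestEigenvalue_mul hβ M
  have h := smallestEigenvalue_mul_le hβ (hdeg.trans hMN)
  rw [hp] at h
  exact le_of_mul_le_mul_right h (coeffNormSq_pos hp0)

/-! ### The infinite Hankel matrix -/

/-- Splitting the coefficients into real and imaginary parts, the Rayleigh quotient of a complex
sequence becomes a quotient of sums over two real polynomials. -/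
theorem exists_rayleigh_eq {β : ℝ} (hβ : 0 < β) {x : ℕ →₀ ℂ} (hx : x ≠ 0) :
    ∃ u v : ℝ[X], 0 < coeffNormSq u + coeffNormSq v ∧
      (∑ j ∈ x.support, ∑ k ∈ x.support,
          (moment β (j + k) : ℂ) * x j * (starRingEnd ℂ) (x k)).re /
        ∑ j ∈ x.support, ‖x j‖ ^ 2 =
      (inner β u u + inner β v v) / (coeffNormSq u + coeffNormSq v) := by
  have hcoeff : ∀ f : ℂ → ℝ, f 0 = 0 → ∀ k,
      (∑ k ∈ x.support, C (f (x k)) * X ^ k : ℝ[X]).coeff k = f (x k) := by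
    intro f hf k
    simp only [finsetSum_coeff, coeff_C_mul_X_pow]
    by_cases hk : k ∈ x.support
    · simp [hk]
    · have hk' : x k = 0 := by simpa using hk
      simp [hk', hf]
  have hns : ∀ f : ℂ → ℝ, f 0 = 0 →
      coeffNormSq (∑ k ∈ x.support, C (f (x k)) * X ^ k) = ∑ k ∈ x.support, f (x k) ^ 2 := by
    intro f hf
    have hs : (∑ k ∈ x.support, C (f (x k)) * X ^ k : ℝ[X]).support ⊆ x.support := by
      intro k hk
      rw [mem_support_iff, hcoeff f hf] at hk
      by_contra h
      have hk' : x k = 0 := by simpa using h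
      exact hk (by rw [hk', hf])
    rw [coeffNormSq_eq_sum hs]
    exact Finset.sum_congr rfl fun k _ => by rw [hcoeff f hf]
  have hden : ∑ j ∈ x.support, ‖x j‖ ^ 2 =
      coeffNormSq (∑ k ∈ x.support, C (x k).re * X ^ k) +
        coeffNormSq (∑ k ∈ x.support, C (x k).im * X ^ k) := by
    rw [hns Complex.re rfl, hns Complex.im rfl, ← Finset.sum_add_distrib]
    refine Finset.sum_congr rfl fun k _ => ?_
    rw [Complex.sq_norm, Complex.normSq_apply]; ring
  refine ⟨∑ k ∈ x.support, C (x k).re * X ^ k, ∑ k ∈ x.support, C (x k).im * X ^ k, ?_, ?_⟩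
  · rw [← hden]
    refine Finset.sum_pos (fun k hk => ?_) (Finsupp.support_nonempty_iff.2 hx)
    have := Finsupp.mem_support_iff.1 hk
    positivity
  · rw [← hden]
    congr 1
    rw [inner_self_eq_sum hβ x.support fun k => (x k).re,
      inner_self_eq_sum hβ x.support fun k => (x k).im, ← Finset.sum_add_distrib, Complex.re_sum]
    refine Finset.sum_congr rfl fun j _ => ?_
    rw [← Finset.sum_add_distrib, Complex.re_sum]
    refine Finset.sum_congr rfl fun k _ => ?_
    simp

/-- The infinite Hankel matrix and its finite sections have the same lower bound: each `λ_N` is a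
value of the infinite Rayleigh quotient, and each such value is at least some `λ_N`. -/
theorem isSmallestEigenvalueInfinite_iff {β m : ℝ} (hβ : 0 < β) :
    IsSmallestEigenvalueInfinite β m ↔ IsGLB (range (smallestEigenvalue β)) m := by
  have hlb : lowerBounds (infiniteRayleigh β) = lowerBounds (range (smallestEigenvalue β)) := by
    ext m
    constructor
    · rintro h _ ⟨N, rfl⟩
      obtain ⟨p, hp0, hdeg, hp⟩ := exists_inner_self_eq_smallestEigenvalue_mul hβ N
      let x : ℕ →₀ ℂ := Finsupp.onFinset p.support (fun k => (p.coeff k : ℂ)) (by simp)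
      have hxs : x.support = p.support := by
        ext k; simp [x]
      have hx : x ≠ 0 := by
        intro h0
        rw [h0, Finsupp.support_zero] at hxs
        exact hp0 (support_eq_empty.1 hxs.symm)
      refine h ⟨x, hx, ?_⟩
      have h1 : ∑ j ∈ x.support, ‖x j‖ ^ 2 = coeffNormSq p := by
        rw [hxs, coeffNormSq]
        exact Finset.sum_congr rfl fun k _ => by simp [x]
      have h2 : (∑ j ∈ x.support, ∑ k ∈ x.support,
          (moment β (j + k) : ℂ) * x j * (starRingEnd ℂ) (x k)).re = inner β p p := by
        have h3 := inner_self_eq_sum hβ p.support p.coeff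
        rw [← p.as_sum_support_C_mul_X_pow] at h3
        rw [h3, hxs, Complex.re_sum]
        refine Finset.sum_congr rfl fun j _ => ?_
        rw [Complex.re_sum]
        refine Finset.sum_congr rfl fun k _ => ?_
        simp [x]
      rw [h1, h2, hp, mul_div_cancel_right₀ _ (coeffNormSq_pos hp0).ne']
    · rintro h _ ⟨x, hx, rfl⟩
      obtain ⟨u, v, hpos, heq⟩ := exists_rayleigh_eq hβ hx
      rw [heq, le_div_iff₀ hpos]
      have hm := h ⟨max u.natDegree v.natDegree, rfl⟩
      have hu := smallestEigenvalue_mul_le hβ (le_max_left u.natDegree v.natDegree)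
      have hv := smallestEigenvalue_mul_le hβ (le_max_right u.natDegree v.natDegree)
      have := mul_le_mul_of_nonneg_right hm hpos.le
      linarith
  simp only [IsSmallestEigenvalueInfinite, IsGLB, hlb]

theorem bddBelow_smallestEigenvalue {β : ℝ} (hβ : 0 < β) :
    BddBelow (range (smallestEigenvalue β)) :=
  ⟨0, by rintro _ ⟨N, rfl⟩; exact (smallestEigenvalue_pos hβ N).le⟩

theorem isSmallestEigenvalueInfinite_iInf {β : ℝ} (hβ : 0 < β) :
    IsSmallestEigenvalueInfinite β (⨅ N, smallestEigenvalue β N) :=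
  (isSmallestEigenvalueInfinite_iff hβ).2 (isGLB_ciInf (bddBelow_smallestEigenvalue hβ))

theorem tendsto_smallestEigenvalue {β : ℝ} (hβ : 0 < β) :
    Filter.Tendsto (smallestEigenvalue β) Filter.atTop (nhds (⨅ N, smallestEigenvalue β N)) :=
  tendsto_atTop_ciInf (antitone_smallestEigenvalue hβ) (bddBelow_smallestEigenvalue hβ)

/-! ### Indeterminacy for `β < 1/2` -/

open ProbabilityTheory in
/-- The Gamma integral `∫ x^n exp(-c x^β) dx` for complex `c`, obtained from the case of real `c`
by analytic continuation: it is the moment generating function of `x^β` under `x^n dx`. -/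
theorem integral_pow_mul_cexp_neg_mul_rpow {β : ℝ} (hβ : 0 < β) (n : ℕ) {c : ℂ} (hc : 0 < c.re) :
    ∫ x in Ioi (0 : ℝ), (x : ℂ) ^ n * Complex.exp (-c * (x ^ β : ℝ)) =
      c ^ (-(n + 1 : ℂ) / β) * (1 / β) * (Real.Gamma ((n + 1) / β) : ℝ) := by
  set μ : Measure ℝ := (volume.restrict (Ioi 0)).withDensity fun x => ENNReal.ofReal (x ^ n)
  set Y : ℝ → ℝ := fun x => x ^ β
  have hae : ∀ᵐ x ∂(volume.restrict (Ioi (0 : ℝ))), 0 < x := ae_restrict_mem measurableSet_Ioi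
  have hμ : ∀ z : ℂ, complexMGF Y μ z =
      ∫ x in Ioi (0 : ℝ), (x : ℂ) ^ n * Complex.exp (z * (x ^ β : ℝ)) := fun z => by
    rw [complexMGF, integral_withDensity_eq_integral_toReal_smul (by fun_prop) (by simp)]
    refine integral_congr_ae ?_
    filter_upwards [hae] with x hx
    rw [ENNReal.toReal_ofReal (by positivity), Complex.real_smul]
    push_cast
    rfl
  have hq : (-1 : ℝ) < n := by have := n.cast_nonneg (α := ℝ); linarith
  have hΓ : 0 < Real.Gamma (((n : ℝ) + 1) / β) := Real.Gamma_pos_of_pos (by positivity)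
  have hset : Iio (0 : ℝ) ⊆ interior (integrableExpSet Y μ) := by
    refine interior_maximal (fun t ht => ?_) isOpen_Iio
    have ht' : 0 < -t := neg_pos.2 ht
    change Integrable _ _
    rw [integrable_withDensity_iff_integrable_smul' (by fun_prop) (by simp)]
    have h1 := integral_rpow_mul_exp_neg_mul_rpow hβ hq ht'
    have h2 : Integrable (fun x : ℝ => x ^ (n : ℝ) * Real.exp (-(-t) * x ^ β))
        (volume.restrict (Ioi 0)) := by
      apply Integrable.of_integral_ne_zero
      rw [h1]
      positivity
    refine h2.congr ?_
    filter_upwards [hae] with x hx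
    rw [ENNReal.toReal_ofReal (by positivity), neg_neg, Real.rpow_natCast, smul_eq_mul]
  have hleft : AnalyticOnNhd ℂ (complexMGF Y μ) {z | z.re < 0} := fun z hz =>
    analyticAt_complexMGF (hset hz)
  have hright : AnalyticOnNhd ℂ (fun z : ℂ => (-z) ^ (-(n + 1 : ℂ) / β) * (1 / β) *
      (Real.Gamma ((n + 1) / β) : ℝ)) {z | z.re < 0} := by
    refine DifferentiableOn.analyticOnNhd (fun z hz => ?_)
      (isOpen_lt Complex.continuous_re continuous_const)
    refine DifferentiableAt.differentiableWithinAt ?_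
    have hz' : -z ∈ Complex.slitPlane := Or.inl (by simpa using hz)
    exact ((differentiableAt_id.neg.cpow_const hz').mul_const _).mul_const _
  have hreal : ∀ t : ℝ, t < 0 → complexMGF Y μ t =
      (-t : ℂ) ^ (-(n + 1 : ℂ) / β) * (1 / β) * (Real.Gamma ((n + 1) / β) : ℝ) := fun t ht => by
    rw [hμ]
    have h1 := integral_rpow_mul_exp_neg_mul_rpow hβ hq (neg_pos.2 ht)
    have h2 : ((-t : ℝ) : ℂ) ^ (-(n + 1 : ℂ) / β) = ((-t) ^ (-((n : ℝ) + 1) / β) : ℝ) := by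
      rw [Complex.ofReal_cpow (neg_pos.2 ht).le]
      push_cast
      rfl
    rw [← Complex.ofReal_neg, h2]
    have h3 : ∫ x in Ioi (0 : ℝ), (x : ℂ) ^ n * Complex.exp (t * (x ^ β : ℝ)) =
        ((∫ x in Ioi (0 : ℝ), x ^ (n : ℝ) * Real.exp (-(-t) * x ^ β) : ℝ) : ℂ) := by
      rw [← integral_complex_ofReal]
      refine integral_congr_ae (Filter.Eventually.of_forall fun x => ?_)
      simp
    rw [h3, h1]
    push_cast
    rfl
  have hconv : IsPreconnected {z : ℂ | z.re < 0} := (convex_halfSpace_re_lt 0).isPreconnected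
  -- The two sides agree at the real points `-1 - 1/(k+1)`, which accumulate at `-1`.
  have hacc : ∃ᶠ z in nhdsWithin (-1 : ℂ) {-1}ᶜ, complexMGF Y μ z =
      (-z) ^ (-(n + 1 : ℂ) / β) * (1 / β) * (Real.Gamma ((n + 1) / β) : ℝ) := by
    have htend : Filter.Tendsto (fun k : ℕ => ((-1 - 1 / ((k : ℝ) + 1) : ℝ) : ℂ)) Filter.atTop
        (nhdsWithin (-1 : ℂ) {-1}ᶜ) := by
      refine tendsto_nhdsWithin_iff.2 ⟨?_, Filter.Eventually.of_forall fun k h => ?_⟩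
      · have h1 := (tendsto_one_div_add_atTop_nhds_zero_nat (𝕜 := ℝ)).const_sub (-1)
        have h2 := (Complex.continuous_ofReal.tendsto _).comp h1
        rw [show (-1 : ℂ) = Complex.ofReal (-1 - 0) by simp]
        exact h2
      · have h1 : (-1 - 1 / ((k : ℝ) + 1) : ℝ) = -1 :=
          Complex.ofReal_injective ((mem_singleton_iff.1 h).trans (by simp))
        have h2 : 0 < 1 / ((k : ℝ) + 1) := by positivity
        linarith
    refine htend.frequently (Filter.Frequently.of_forall fun k => ?_)
    exact hreal _ (by have h2 : 0 < 1 / ((k : ℝ) + 1) := by positivity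
                      linarith)
  have hmain := hleft.eqOn_of_preconnected_of_frequently_eq hright hconv (z₀ := -1) (by simp) hacc
  have := hmain (show -c ∈ {z : ℂ | z.re < 0} by simpa using hc)
  rw [hμ] at this
  simpa using this

/-- Adding `sin(tan(πβ) x^β)` to the constant density `1` with respect to `exp(-x^β) dx` changes no
moment: the integral is the imaginary part of a Gamma integral with a real value. -/
theorem integral_pow_mul_weight_mul_sin {β : ℝ} (hβ : 0 < β) (hβ' : β < 1 / 2) (n : ℕ) :
    ∫ x in Ioi (0 : ℝ), x ^ n * (weight β x * Real.sin (Real.tan (Real.pi * β) * x ^ β)) = 0 := by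
  set T := Real.tan (Real.pi * β) with hT
  have hπ := Real.pi_pos
  have hcos : 0 < Real.cos (Real.pi * β) :=
    Real.cos_pos_of_mem_Ioo ⟨by nlinarith, by nlinarith⟩
  set c : ℂ := 1 - T * Complex.I with hc
  have hcre : c.re = 1 := by simp [hc]
  have hint : Integrable (fun x : ℝ => (x : ℂ) ^ n * Complex.exp (-c * (x ^ β : ℝ)))
      (volume.restrict (Ioi 0)) := by
    have h0 := integrable_weightMeasure_iff.1 (integrable_pow_weightMeasure hβ n)
    refine h0.mono' (by fun_prop) ?_
    filter_upwards [ae_restrict_mem measurableSet_Ioi] with x hx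
    have hx' : (0 : ℝ) < x := hx
    have h1 : (-c * ((x ^ β : ℝ) : ℂ)).re = -x ^ β := by
      rw [Complex.re_mul_ofReal, Complex.neg_re, hcre]; ring
    rw [norm_mul, norm_pow, Complex.norm_exp, h1, Complex.norm_real, Real.norm_of_nonneg hx'.le,
      weight, smul_eq_mul, mul_comm]
  have h := integral_pow_mul_cexp_neg_mul_rpow hβ n (c := c) (by rw [hcre]; norm_num)
  -- `c = exp(-iπβ) / cos(πβ)`, so its power with exponent `-(n+1)/β` is real.
  have hcpolar : c = ((Real.cos (Real.pi * β))⁻¹ : ℝ) * Complex.exp ((-(Real.pi * β) : ℝ) *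
      Complex.I) := by
    rw [Complex.exp_mul_I, ← Complex.ofReal_cos, ← Complex.ofReal_sin, Real.cos_neg, Real.sin_neg,
      hc, hT, Real.tan_eq_sin_div_cos]
    have := Complex.ofReal_ne_zero.2 hcos.ne'
    push_cast at this ⊢
    field_simp
    ring
  have hpow : c ^ (-(n + 1 : ℂ) / β) =
      (((Real.cos (Real.pi * β))⁻¹ ^ (-((n : ℝ) + 1) / β) * (-1) ^ (n + 1) : ℝ) : ℂ) := by
    have hβc : (β : ℂ) ≠ 0 := Complex.ofReal_ne_zero.2 hβ.ne'
    set L := Real.log (Real.cos (Real.pi * β))⁻¹ with hL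
    have hexp : c = Complex.exp (L + (-(Real.pi * β) : ℝ) * Complex.I) := by
      rw [Complex.exp_add, hcpolar, ← Complex.ofReal_exp, hL, Real.exp_log (inv_pos.2 hcos)]
    have him : ((L : ℂ) + (-(Real.pi * β) : ℝ) * Complex.I).im = -(Real.pi * β) := by simp
    have hlog : Complex.log c = L + (-(Real.pi * β) : ℝ) * Complex.I := by
      rw [hexp, Complex.log_exp] <;> rw [him] <;> nlinarith
    rw [Complex.cpow_def_of_ne_zero (by rw [hexp]; exact Complex.exp_ne_zero _), hlog,
      Real.rpow_def_of_pos (inv_pos.2 hcos), ← hL]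
    have hsplit : ((L : ℂ) + (-(Real.pi * β) : ℝ) * Complex.I) * (-(n + 1 : ℂ) / β) =
        ((L * (-((n : ℝ) + 1) / β) : ℝ) : ℂ) + ((n + 1 : ℕ) : ℂ) * (Real.pi * Complex.I) := by
      push_cast
      field_simp
      ring
    rw [hsplit, Complex.exp_add, Complex.exp_nat_mul, Complex.exp_pi_mul_I]
    push_cast
    rfl
  rw [hpow] at h
  have him := congrArg Complex.im h
  have hre : (((((Real.cos (Real.pi * β))⁻¹ ^ (-((n : ℝ) + 1) / β) * (-1) ^ (n + 1) : ℝ) : ℂ)) *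
      (1 / β) * (Real.Gamma ((n + 1) / β) : ℝ)).im = 0 := by
    rw [← Complex.ofReal_one, ← Complex.ofReal_div, ← Complex.ofReal_mul, ← Complex.ofReal_mul,
      Complex.ofReal_im]
  rw [hre] at him
  have h2 := integral_im hint
  simp only [RCLike.im_to_complex] at h2
  rw [him] at h2
  refine Eq.trans (integral_congr_ae (Filter.Eventually.of_forall fun x => ?_)) h2
  have h3 : (x : ℂ) ^ n * Complex.exp (-c * (x ^ β : ℝ)) =
      ((x ^ n * weight β x : ℝ) : ℂ) * Complex.exp ((T * x ^ β : ℝ) * Complex.I) := by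
    rw [weight]
    push_cast
    rw [mul_assoc, ← Complex.exp_add, hc]
    congr 2
    ring
  simp only [h3, Complex.im_ofReal_mul, Complex.exp_ofReal_mul_I_im]
  ring

theorem isMomentSolution_weightMeasure {β : ℝ} (hβ : 0 < β) :
    IsMomentSolution (Ici 0) (moment β) (weightMeasure β) := by
  refine ⟨?_, fun n => ⟨integrable_pow_weightMeasure hβ n, integral_pow_weightMeasure β n⟩⟩
  have := ae_iff.1 (ae_weightMeasure_pos β)
  refine measure_mono_null (fun x hx => ?_) this
  simp only [mem_compl_iff, mem_Ici, not_le] at hx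
  simpa using hx.le

theorem IsMomentSolution.mono {S T : Set ℝ} (hST : S ⊆ T) {s : ℕ → ℝ} {ν : Measure ℝ}
    (h : IsMomentSolution S s ν) : IsMomentSolution T s ν :=
  ⟨measure_mono_null (compl_subset_compl.2 hST) h.1, h.2⟩

/-- The second solution has the density `1 + sin(tan(πβ) x^β)` with respect to `exp(-x^β) dx`. -/
theorem momentIndeterminate_Ici {β : ℝ} (hβ : 0 < β) (hβ' : β < 1 / 2) :
    MomentIndeterminate (Ici 0) (moment β) := by
  set T := Real.tan (Real.pi * β) with hT
  have hTpos : 0 < T := by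
    have := Real.pi_pos
    exact Real.tan_pos_of_pos_of_lt_pi_div_two (by positivity) (by nlinarith)
  set g : ℝ → ℝ := fun x => weight β x * (1 + Real.sin (T * x ^ β)) with hg
  have hgnn : ∀ x, 0 ≤ g x := fun x =>
    mul_nonneg (weight_pos β x).le (by linarith [Real.neg_one_le_sin (T * x ^ β)])
  have hgm : Measurable g := by fun_prop
  set ν : Measure ℝ := (volume.restrict (Ioi 0)).withDensity fun x => ENNReal.ofReal (g x) with hν
  have h0 : ∀ n : ℕ, Integrable (fun x => weight β x • x ^ n) (volume.restrict (Ioi 0)) :=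
    fun n => integrable_weightMeasure_iff.1 (integrable_pow_weightMeasure hβ n)
  have hsin : ∀ n : ℕ, Integrable (fun x => x ^ n * (weight β x * Real.sin (T * x ^ β)))
      (volume.restrict (Ioi 0)) := fun n => by
    refine (h0 n).norm.mono' (by fun_prop) (Filter.Eventually.of_forall fun x => ?_)
    rw [← mul_assoc, norm_mul, mul_comm (x ^ n), smul_eq_mul]
    exact mul_le_of_le_one_right (norm_nonneg _) (Real.abs_sin_le_one _)
  have hsplit : ∀ n : ℕ, (fun x => (ENNReal.ofReal (g x)).toReal • x ^ n) = fun x =>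
      weight β x • x ^ n + x ^ n * (weight β x * Real.sin (T * x ^ β)) := fun n => by
    ext x
    rw [ENNReal.toReal_ofReal (hgnn x), hg, smul_eq_mul, smul_eq_mul]
    ring
  refine ⟨weightMeasure β, ν, isMomentSolution_weightMeasure hβ, ⟨?_, fun n => ⟨?_, ?_⟩⟩, ?_⟩
  · refine withDensity_absolutelyContinuous _ _ ?_
    rw [Measure.restrict_apply measurableSet_Ici.compl]
    convert measure_empty (μ := (volume : Measure ℝ))
    ext x
    simp only [mem_inter_iff, mem_compl_iff, mem_Ici, not_le, mem_Ioi, mem_empty_iff_false,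
      iff_false, not_and, not_lt]
    exact fun h => h.le
  · rw [hν, integrable_withDensity_iff_integrable_smul' (by fun_prop) (by simp), hsplit n]
    exact (h0 n).add (hsin n)
  · rw [hν, integral_withDensity_eq_integral_toReal_smul (by fun_prop) (by simp), hsplit n,
      integral_add (h0 n) (hsin n), integral_pow_mul_weight_mul_sin hβ hβ' n, add_zero,
      ← integral_weightMeasure, integral_pow_weightMeasure]
  · intro heq
    rw [weightMeasure, hν, withDensity_eq_iff_of_sigmaFinite (by fun_prop) (by fun_prop)] at heq
    -- On `(0, a)` the argument of the sine lies in `(0, π)`.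
    set a : ℝ := (Real.pi / T) ^ β⁻¹ with ha
    have hapos : 0 < a := by have := Real.pi_pos; positivity
    have hno : ∀ᵐ x ∂(volume.restrict (Ioo 0 a)), False := by
      have hsub : Ioo 0 a ⊆ Ioi 0 := fun x hx => hx.1
      filter_upwards [ae_restrict_of_ae_restrict_of_subset hsub heq,
        ae_restrict_mem measurableSet_Ioo] with x hx hxa
      have h1 : weight β x = g x := by
        have := congrArg ENNReal.toReal hx
        rwa [ENNReal.toReal_ofReal (weight_pos β x).le, ENNReal.toReal_ofReal (hgnn x)] at this
      have h2 : 0 < T * x ^ β := mul_pos hTpos (Real.rpow_pos_of_pos hxa.1 _)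
      have h3 : T * x ^ β < Real.pi := by
        have h4 : x ^ β < a ^ β := Real.rpow_lt_rpow hxa.1.le hxa.2 hβ
        rw [ha, Real.rpow_inv_rpow (by have := Real.pi_pos; positivity) hβ.ne', lt_div_iff₀ hTpos]
          at h4
        linarith
      have h5 := Real.sin_pos_of_pos_of_lt_pi h2 h3
      have h6 := mul_pos (weight_pos β x) h5
      have h7 : g x = weight β x + weight β x * Real.sin (T * x ^ β) := by rw [hg]; ring
      linarith
    have h8 := ae_iff.1 hno
    simp only [not_false_eq_true, ofPred_true, Measure.restrict_apply_univ, Real.volume_Ioo,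
      sub_zero, ENNReal.ofReal_eq_zero] at h8
    linarith

theorem momentIndeterminate_univ {β : ℝ} (hβ : 0 < β) (hβ' : β < 1 / 2) :
    MomentIndeterminate univ (moment β) := by
  obtain ⟨ν₁, ν₂, h₁, h₂, hne⟩ := momentIndeterminate_Ici hβ hβ'
  exact ⟨ν₁, ν₂, h₁.mono (subset_univ _), h₂.mono (subset_univ _), hne⟩

/-! ### Bounded point evaluations for `β < 1/2` -/

theorem exists_derivative_eq (q : ℝ[X]) : ∃ Q : ℝ[X], derivative Q = q ∧ Q.eval 0 = 0 := by
  refine ⟨∑ k ∈ Finset.range (q.natDegree + 1), C (q.coeff k / (k + 1)) * X ^ (k + 1), ?_, ?_⟩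
  · conv_rhs => rw [q.as_sum_range_C_mul_X_pow]
    rw [derivative_sum]
    refine Finset.sum_congr rfl fun k _ => ?_
    rw [derivative_C_mul_X_pow]
    congr 2
    have : (k : ℝ) + 1 ≠ 0 := by positivity
    push_cast
    field_simp
  · simp [eval_finsetSum]

/-- The primitive `Q` of `p²` turns the `L²` norm of `p` into a pointwise bound on `[0, ∞)`. -/
theorem abs_eval_le_of_derivative_eq_mul_self {β : ℝ} (hβ : 0 < β) {p Q : ℝ[X]}
    (hQ : derivative Q = p * p) (hQ0 : Q.eval 0 = 0) {x : ℝ} (hx : 0 ≤ x) :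
    |Q.eval x| ≤ inner β p p * Real.exp (x ^ β) := by
  have h1 : ∫ t in (0 : ℝ)..x, (p * p).eval t = Q.eval x := by
    rw [intervalIntegral.integral_eq_sub_of_hasDerivAt (f := fun t => Q.eval t), hQ0, sub_zero]
    · intro t _
      rw [← hQ]
      exact Q.hasDerivAt t
    · exact (p * p).continuous.intervalIntegrable _ _
  have hnn : ∀ t, 0 ≤ (p * p).eval t := fun t => by rw [eval_mul]; exact mul_self_nonneg _
  have hint := integrable_weightMeasure_iff.1
    (integrable_eval (integrable_pow_weightMeasure hβ) (p * p))
  rw [← h1, intervalIntegral.integral_of_le hx, abs_of_nonneg (integral_nonneg fun t => hnn t),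
    inner_eq_integral, integral_weightMeasure, ← integral_mul_const]
  refine (setIntegral_mono_on ((p * p).continuous.integrableOn_Ioc)
    (IntegrableOn.mono_set (hint.mul_const _) Ioc_subset_Ioi_self) measurableSet_Ioc
    fun t ht => ?_).trans
    (setIntegral_mono_set (hint.mul_const _) (Filter.Eventually.of_forall fun t => ?_)
      Ioc_subset_Ioi_self.eventuallyLE)
  · have h2 : 1 ≤ weight β t * Real.exp (x ^ β) := by
      rw [weight, ← Real.exp_add]
      refine Real.one_le_exp ?_
      linarith [Real.rpow_le_rpow ht.1.le ht.2 hβ.le]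
    calc (p * p).eval t = 1 * (p * p).eval t := (one_mul _).symm
      _ ≤ (weight β t * Real.exp (x ^ β)) * (p * p).eval t :=
        mul_le_mul_of_nonneg_right h2 (hnn t)
      _ = weight β t • (p * p).eval t * Real.exp (x ^ β) := by rw [smul_eq_mul]; ring
  · exact mul_nonneg (mul_nonneg (weight_pos β t).le (hnn t)) (Real.exp_pos _).le

theorem norm_aeval_le_sum (R : ℝ[X]) (z : ℂ) :
    ‖aeval z R‖ ≤ ∑ k ∈ Finset.range (R.natDegree + 1), |R.coeff k| * ‖z‖ ^ k := by
  rw [aeval_eq_sum_range]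
  refine (norm_sum_le _ _).trans (Finset.sum_le_sum fun k _ => ?_)
  rw [norm_smul, norm_pow, Real.norm_eq_abs]

theorem exists_norm_aeval_le_mul_exp (R : ℝ[X]) :
    ∃ K : ℝ, ∀ z : ℂ, ‖aeval z R‖ ≤ K * Real.exp ‖z‖ := by
  refine ⟨∑ k ∈ Finset.range (R.natDegree + 1), |R.coeff k| * k.factorial, fun z => ?_⟩
  refine (norm_aeval_le_sum R z).trans ?_
  rw [Finset.sum_mul]
  refine Finset.sum_le_sum fun k _ => ?_
  have h := Real.pow_div_factorial_le_exp ‖z‖ (norm_nonneg z) k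
  rw [div_le_iff₀ (by positivity)] at h
  rw [mul_assoc]
  exact mul_le_mul_of_nonneg_left (by linarith) (abs_nonneg _)

theorem tendsto_pow_mul_exp_neg_mul_rpow {A γ : ℝ} (hA : 0 < A) (hγ : 0 < γ) (k : ℕ) :
    Filter.Tendsto (fun x : ℝ => x ^ k * Real.exp (-A * x ^ γ)) Filter.atTop (nhds 0) := by
  have h := (tendsto_rpow_mul_exp_neg_mul_atTop_nhds_zero (k / γ) A hA).comp
    (tendsto_rpow_atTop hγ)
  refine h.congr' ?_
  filter_upwards [Filter.eventually_ge_atTop 0] with x hx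
  simp only [Function.comp_apply]
  rw [← Real.rpow_mul hx, mul_div_cancel₀ _ hγ.ne', Real.rpow_natCast]

/-- A polynomial bounded by `I exp(x^β)` on `[0, ∞)` is bounded by `I exp(A |z|^β)` in the whole
plane, where `A cos(πβ) = 1`. With `z = -s²` the slit plane becomes the right half-plane, and the
Phragmén–Lindelöf principle applies to `Q(-s²) exp(-A s^(2β))`. -/
theorem norm_aeval_le_of_abs_eval_le {β : ℝ} (hβ : 0 < β) (hβ' : β < 1 / 2) {Q : ℝ[X]} {I : ℝ}
    (hQ : ∀ x : ℝ, 0 ≤ x → |Q.eval x| ≤ I * Real.exp (x ^ β)) (z : ℂ) :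
    ‖aeval z Q‖ ≤ I * Real.exp ((Real.cos (Real.pi * β))⁻¹ * ‖z‖ ^ β) := by
  have hπ := Real.pi_pos
  have hcos : 0 < Real.cos (Real.pi * β) :=
    Real.cos_pos_of_mem_Ioo ⟨by nlinarith, by nlinarith⟩
  set A := (Real.cos (Real.pi * β))⁻¹ with hA
  have hApos : 0 < A := inv_pos.2 hcos
  set f : ℂ → ℂ := fun s => aeval (-s ^ 2) Q * Complex.exp (-A * s ^ ((2 * β : ℝ) : ℂ)) with hf
  have hnorm : ∀ s : ℂ, ‖f s‖ = ‖aeval (-s ^ 2) Q‖ *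
      Real.exp (-A * (‖s‖ ^ (2 * β) * Real.cos (s.arg * (2 * β)))) := fun s => by
    rw [hf, norm_mul, Complex.norm_exp, ← Complex.ofReal_neg, Complex.re_ofReal_mul,
      Complex.cpow_ofReal_re]
  have hcosnn : ∀ s : ℂ, 0 ≤ s.re → 0 ≤ Real.cos (s.arg * (2 * β)) := fun s hs => by
    have h := abs_le.1 (Complex.abs_arg_le_pi_div_two_iff.2 hs)
    exact Real.cos_nonneg_of_mem_Icc ⟨by nlinarith [h.1, h.2], by nlinarith [h.1, h.2]⟩
  have hle : ∀ s : ℂ, 0 ≤ s.re → ‖f s‖ ≤ ‖aeval (-s ^ 2) Q‖ := fun s hs => by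
    rw [hnorm]
    refine mul_le_of_le_one_right (norm_nonneg _) (Real.exp_le_one_iff.2 ?_)
    have := mul_nonneg hApos.le (mul_nonneg (Real.rpow_nonneg (norm_nonneg s) (2 * β))
      (hcosnn s hs))
    linarith
  have hcomp : ∀ s : ℂ, aeval (-s ^ 2) Q = aeval s (Q.comp (-X ^ 2)) := fun s => by
    rw [aeval_comp]; simp
  have hd : DiffContOnCl ℂ f {s | 0 < s.re} := by
    constructor
    · intro s hs
      refine DifferentiableAt.differentiableWithinAt ?_
      have hs' : s ∈ Complex.slitPlane := Or.inl hs
      refine DifferentiableAt.mul ?_ ((differentiableAt_id.cpow_const hs').const_mul _).cexp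
      simp only [hcomp]
      exact (Q.comp (-X ^ 2)).differentiable_aeval.differentiableAt
    · rw [Complex.closure_setOfPred_lt_re]
      intro s hs
      refine ContinuousAt.continuousWithinAt ?_
      have h1 : ContinuousAt (fun s : ℂ => s ^ ((2 * β : ℝ) : ℂ)) s :=
        (Complex.continuousAt_cpow_of_re_pos (p := (s, ((2 * β : ℝ) : ℂ))) (Or.inl hs)
          (by simpa using hβ)).comp (f := fun s : ℂ => (s, ((2 * β : ℝ) : ℂ))) (by fun_prop)
      refine ContinuousAt.mul ?_ (by fun_prop)
      simp only [hcomp]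
      exact (Q.comp (-X ^ 2)).continuous_aeval.continuousAt
  have hexp : ∃ c < (2 : ℝ), ∃ B, f =O[Bornology.cobounded ℂ ⊓ Filter.principal {s | 0 < s.re}]
      fun s => Real.exp (B * ‖s‖ ^ c) := by
    obtain ⟨K, hK⟩ := exists_norm_aeval_le_mul_exp (Q.comp (-X ^ 2))
    refine ⟨1, by norm_num, 1, Asymptotics.IsBigO.of_bound K ?_⟩
    refine Filter.eventually_inf_principal.2 (Filter.Eventually.of_forall fun s hs => ?_)
    refine (hle s (le_of_lt hs)).trans ?_
    rw [hcomp, Real.norm_of_nonneg (Real.exp_pos _).le, Real.rpow_one, one_mul]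
    exact hK s
  have hre : Filter.IsBoundedUnder (· ≤ ·) Filter.atTop fun x : ℝ => ‖f x‖ := by
    set R := Q.comp (-X ^ 2) with hR
    have hlim : Filter.Tendsto (fun x : ℝ => ∑ k ∈ Finset.range (R.natDegree + 1),
        |R.coeff k| * (x ^ k * Real.exp (-A * x ^ (2 * β)))) Filter.atTop (nhds 0) := by
      have := tendsto_finsetSum (Finset.range (R.natDegree + 1)) fun k _ =>
        (tendsto_pow_mul_exp_neg_mul_rpow hApos (γ := 2 * β) (by linarith) k).const_mul
          |R.coeff k|
      simpa using this
    refine hlim.isBoundedUnder_le.mono_le ?_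
    filter_upwards [Filter.eventually_ge_atTop 0] with x hx
    rw [hnorm, hcomp, Complex.arg_ofReal_of_nonneg hx, zero_mul, Real.cos_zero, mul_one,
      Complex.norm_real, Real.norm_of_nonneg hx]
    refine (mul_le_mul_of_nonneg_right (norm_aeval_le_sum R x) (Real.exp_pos _).le).trans
      (le_of_eq ?_)
    rw [Finset.sum_mul, Complex.norm_real, Real.norm_of_nonneg hx]
    exact Finset.sum_congr rfl fun k _ => by ring
  have him : ∀ x : ℝ, ‖f (x * Complex.I)‖ ≤ I := fun x => by
    have h1 : -((x : ℂ) * Complex.I) ^ 2 = ((x ^ 2 : ℝ) : ℂ) := by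
      rw [mul_pow, Complex.I_sq]; push_cast; ring
    have h2 : ‖(x : ℂ) * Complex.I‖ ^ (2 * β) * Real.cos (((x : ℂ) * Complex.I).arg * (2 * β)) =
        (x ^ 2) ^ β * Real.cos (Real.pi * β) := by
      rw [norm_mul, Complex.norm_I, mul_one, Complex.norm_real, Real.norm_eq_abs,
        Real.rpow_mul (abs_nonneg x), Real.rpow_two, sq_abs]
      rcases lt_trichotomy x 0 with hx | hx | hx
      · have h3 : ((x : ℂ) * Complex.I).arg = -(Real.pi / 2) :=
          Complex.arg_eq_neg_pi_div_two_iff.2 (by simpa using hx)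
        rw [h3, show -(Real.pi / 2) * (2 * β) = -(Real.pi * β) by ring, Real.cos_neg]
      · rw [hx]; simp [Real.zero_rpow hβ.ne']
      · have h3 : ((x : ℂ) * Complex.I).arg = Real.pi / 2 :=
          Complex.arg_eq_pi_div_two_iff.2 (by simpa using hx)
        rw [h3, show Real.pi / 2 * (2 * β) = Real.pi * β by ring]
    have h4 : -A * ((x ^ 2) ^ β * Real.cos (Real.pi * β)) = -(x ^ 2) ^ β := by
      rw [hA]; field_simp
    rw [hnorm, h1, h2, h4, Complex.coe_algebraMap.symm, aeval_algebraMap_apply,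
      Complex.coe_algebraMap, Complex.norm_real, Real.norm_eq_abs, Real.exp_neg,
      ← div_eq_mul_inv, div_le_iff₀ (Real.exp_pos _)]
    exact hQ _ (sq_nonneg x)
  obtain ⟨s, hs0, hsz⟩ : ∃ s : ℂ, 0 ≤ s.re ∧ -s ^ 2 = z := by
    obtain ⟨s, hs⟩ := IsAlgClosed.exists_pow_nat_eq (-z) two_pos
    rcases le_total 0 s.re with h | h
    · exact ⟨s, h, by rw [hs, neg_neg]⟩
    · exact ⟨-s, by simpa using h, by rw [neg_sq, hs, neg_neg]⟩
  have hPL := PhragmenLindelof.right_half_plane_of_bounded_on_real hd hexp hre him hs0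
  rw [hnorm, hsz] at hPL
  have hzs : ‖z‖ ^ β = ‖s‖ ^ (2 * β) := by
    rw [← hsz, norm_neg, norm_pow, Real.rpow_mul (norm_nonneg s), Real.rpow_two]
  have hI : 0 ≤ I := (norm_nonneg _).trans (him 0)
  rw [neg_mul, Real.exp_neg, ← div_eq_mul_inv, div_le_iff₀ (Real.exp_pos _)] at hPL
  refine hPL.trans (mul_le_mul_of_nonneg_left (Real.exp_le_exp.2 ?_) hI)
  rw [hzs]
  exact mul_le_mul_of_nonneg_left (mul_le_of_le_one_right
    (Real.rpow_nonneg (norm_nonneg s) _) (Real.cos_le_one _)) hApos.le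

/-- An upper bound for the square of the norm, in `L²(w_β)`, of the evaluation at any point of
modulus at most `r`. -/
noncomputable def evalBound (β r : ℝ) : ℝ :=
  Real.exp ((Real.cos (Real.pi * β))⁻¹ * (r + 1) ^ β)

/-- Point evaluations are bounded on real polynomials: Cauchy's estimate recovers `p² = Q'` from the
primitive `Q`. -/
theorem sq_norm_aeval_le {β : ℝ} (hβ : 0 < β) (hβ' : β < 1 / 2) (p : ℝ[X]) {r : ℝ} {z : ℂ}
    (hz : ‖z‖ ≤ r) : ‖aeval z p‖ ^ 2 ≤ inner β p p * evalBound β r := by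
  obtain ⟨Q, hQ, hQ0⟩ := exists_derivative_eq (p * p)
  have hcos : 0 < Real.cos (Real.pi * β) := by
    have := Real.pi_pos
    exact Real.cos_pos_of_mem_Ioo ⟨by nlinarith, by nlinarith⟩
  have h1 : ∀ w ∈ Metric.sphere z 1, ‖aeval w Q‖ ≤ inner β p p * evalBound β r := fun w hw => by
    refine (norm_aeval_le_of_abs_eval_le hβ hβ'
      (fun x hx => abs_eval_le_of_derivative_eq_mul_self hβ hQ hQ0 hx) w).trans ?_
    refine mul_le_mul_of_nonneg_left (Real.exp_le_exp.2 ?_) (inner_self_nonneg β p)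
    have hw' : ‖w‖ ≤ r + 1 := by
      have := norm_sub_norm_le w z
      rw [mem_sphere_iff_norm] at hw
      linarith
    have := Real.rpow_le_rpow (norm_nonneg w) hw' hβ.le
    exact mul_le_mul_of_nonneg_left this (inv_pos.2 hcos).le
  have h2 := Complex.norm_deriv_le_of_forall_mem_sphere_norm_le one_pos
    Q.differentiable_aeval.diffContOnCl h1
  rw [(Q.hasDerivAt_aeval z).deriv, hQ, map_mul, norm_mul, div_one, ← sq] at h2
  exact h2

/-- The Christoffel kernel is bounded on discs: evaluate at `z` the real and the imaginary parts of
the complex polynomial `∑ conj(P_j(z)) P_j`. -/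
theorem sum_sq_norm_orthonormalEval_le {β : ℝ} (hβ : 0 < β) (hβ' : β < 1 / 2) (n : ℕ) {r : ℝ}
    {z : ℂ} (hz : ‖z‖ ≤ r) :
    ∑ j ∈ Finset.range n, ‖orthonormalEval β j z‖ ^ 2 ≤ 2 * evalBound β r := by
  set S := ∑ j ∈ Finset.range n, ‖orthonormalEval β j z‖ ^ 2 with hS
  set u : ℝ[X] := ∑ j ∈ Finset.range n, C (orthonormalEval β j z).re * orthonormalPoly β j with hu
  set v : ℝ[X] := ∑ j ∈ Finset.range n, C (orthonormalEval β j z).im * orthonormalPoly β j with hv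
  have hSnn : 0 ≤ S := by positivity
  have h1 : aeval z u - Complex.I * aeval z v = S := by
    simp only [hu, hv, hS, map_sum, map_mul, aeval_C, Finset.mul_sum, ← Finset.sum_sub_distrib,
      Complex.ofReal_sum]
    refine Finset.sum_congr rfl fun j _ => ?_
    have h2 := Complex.conj_mul' (orthonormalEval β j z)
    rw [Complex.ofReal_pow, ← h2]
    have h3 : (starRingEnd ℂ) (orthonormalEval β j z) =
        (orthonormalEval β j z).re - (orthonormalEval β j z).im * Complex.I := by
      apply Complex.ext <;> simp
    rw [h3]
    simp only [orthonormalEval, Complex.coe_algebraMap]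
    ring
  have h2 : inner β u u + inner β v v = S := by
    rw [hu, hv, inner_sum_orthonormalPoly hβ, inner_sum_orthonormalPoly hβ,
      ← Finset.sum_add_distrib]
    refine Finset.sum_congr rfl fun j _ => ?_
    rw [Complex.sq_norm, Complex.normSq_apply]; ring
  have h3 : S ≤ ‖aeval z u‖ + ‖aeval z v‖ := by
    have := norm_sub_le (aeval z u) (Complex.I * aeval z v)
    rwa [h1, Complex.norm_real, Real.norm_of_nonneg hSnn, norm_mul, Complex.norm_I, one_mul]
      at this
  have hu' := sq_norm_aeval_le hβ hβ' u hz
  have hv' := sq_norm_aeval_le hβ hβ' v hz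
  have h4 : S * S ≤ S * (2 * evalBound β r) := by
    have h5 : S * S ≤ (‖aeval z u‖ + ‖aeval z v‖) ^ 2 := by
      rw [sq]; exact mul_self_le_mul_self hSnn h3
    have h6 : S * (2 * evalBound β r) =
        2 * (inner β u u * evalBound β r + inner β v v * evalBound β r) := by rw [← h2]; ring
    rw [h6]
    nlinarith [sq_nonneg (‖aeval z u‖ - ‖aeval z v‖)]
  rcases hSnn.eq_or_lt with h | h
  · rw [← h]; unfold evalBound; positivity
  · exact le_of_mul_le_mul_left h4 h

/-! ### Integrals over circles -/

theorem aeval_eq_sum_support (p : ℝ[X]) (z : ℂ) :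
    aeval z p = ∑ k ∈ p.support, p.coeff k • z ^ k := by
  simp only [aeval_def, eval₂_eq_sum, sum_def, Algebra.smul_def]

theorem integral_cos_int_mul {m : ℤ} (hm : m ≠ 0) :
    ∫ φ in (0 : ℝ)..(2 * Real.pi), Real.cos (m * φ) = 0 := by
  have hm' : (m : ℝ) ≠ 0 := Int.cast_ne_zero.2 hm
  rw [intervalIntegral.integral_comp_mul_left (fun x => Real.cos x) hm', integral_cos, mul_zero,
    Real.sin_zero, sub_zero]
  have : (m : ℝ) * (2 * Real.pi) = ((2 * m : ℤ) : ℝ) * Real.pi := by push_cast; ring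
  rw [this, Real.sin_int_mul_pi, smul_zero]

/-- Parseval's identity for a polynomial on the circle of radius `r`. -/
theorem integral_sq_norm_aeval_circle (p : ℝ[X]) (r : ℝ) :
    ∫ φ in (0 : ℝ)..(2 * Real.pi), ‖aeval (r * Complex.exp (φ * Complex.I)) p‖ ^ 2 =
      2 * Real.pi * ∑ k ∈ p.support, (p.coeff k * r ^ k) ^ 2 := by
  set b : ℕ → ℝ := fun k => p.coeff k * r ^ k with hb
  -- The coefficients are real, so only cosines occur in the expansion of the square.
  have h1 : ∀ φ : ℝ, ‖aeval (r * Complex.exp (φ * Complex.I)) p‖ ^ 2 =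
      ∑ j ∈ p.support, ∑ k ∈ p.support, b j * b k * Real.cos (((j - k : ℤ) : ℝ) * φ) := by
    intro φ
    have h2 : aeval (r * Complex.exp (φ * Complex.I)) p =
        ∑ k ∈ p.support, (b k : ℂ) * Complex.exp ((k * φ : ℝ) * Complex.I) := by
      rw [aeval_eq_sum_support]
      refine Finset.sum_congr rfl fun k _ => ?_
      rw [mul_pow, ← Complex.exp_nat_mul, hb, Complex.real_smul]
      push_cast
      rw [mul_assoc, mul_assoc]
    rw [h2, Complex.sq_norm, Complex.normSq_apply, Complex.re_sum, Complex.im_sum,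
      Finset.sum_mul_sum, Finset.sum_mul_sum, ← Finset.sum_add_distrib]
    refine Finset.sum_congr rfl fun j _ => ?_
    rw [← Finset.sum_add_distrib]
    refine Finset.sum_congr rfl fun k _ => ?_
    simp only [Complex.re_ofReal_mul, Complex.im_ofReal_mul, Complex.exp_ofReal_mul_I_re,
      Complex.exp_ofReal_mul_I_im]
    push_cast
    rw [sub_mul, Real.cos_sub]
    ring
  simp only [h1]
  have hii : ∀ j k : ℕ, IntervalIntegrable
      (fun φ : ℝ => b j * b k * Real.cos (((j - k : ℤ) : ℝ) * φ)) volume 0 (2 * Real.pi) :=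
    fun j k => Continuous.intervalIntegrable (by fun_prop) _ _
  rw [intervalIntegral.integral_finsetSum fun j _ =>
    Continuous.intervalIntegrable (by fun_prop) _ _, Finset.mul_sum]
  refine Finset.sum_congr rfl fun j hj => ?_
  rw [intervalIntegral.integral_finsetSum fun k _ => hii j k, Finset.sum_eq_single j]
  · simp [hb]
    ring
  · intro k _ hk
    rw [intervalIntegral.integral_const_mul, integral_cos_int_mul (by omega), mul_zero]
  · exact fun h => absurd hj h

theorem circleKernel_self (β : ℝ) (j : ℕ) :
    circleKernel β j j = ((2 * Real.pi * coeffNormSq (orthonormalPoly β j) : ℝ) : ℂ) := by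
  have h := integral_sq_norm_aeval_circle (orthonormalPoly β j) 1
  simp only [Complex.ofReal_one, one_mul, one_pow, mul_one] at h
  rw [coeffNormSq, ← h, ← intervalIntegral.integral_ofReal, circleKernel]
  refine intervalIntegral.integral_congr fun φ _ => ?_
  simp only [orthonormalEval, Complex.mul_conj']
  push_cast
  rfl

/-- Cauchy–Schwarz for the coefficients of the expansion in orthonormal polynomials. -/
theorem coeffNormSq_le {β : ℝ} (hβ : 0 < β) {N : ℕ} {p : ℝ[X]} (hp : p.natDegree ≤ N) :
    coeffNormSq p ≤
      inner β p p * ∑ j ∈ Finset.range (N + 1), coeffNormSq (orthonormalPoly β j) := by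
  obtain ⟨c, hc⟩ := exists_sum_orthonormalPoly hβ hp
  have hcoeff : ∀ k, p.coeff k =
      ∑ j ∈ Finset.range (N + 1), c j * (orthonormalPoly β j).coeff k := fun k => by
    conv_lhs => rw [hc]
    simp only [finsetSum_coeff, coeff_C_mul]
  have hin : inner β p p = ∑ j ∈ Finset.range (N + 1), c j ^ 2 := by
    conv_lhs => rw [hc]
    exact inner_sum_orthonormalPoly hβ _ c
  have h1 : ∑ j ∈ Finset.range (N + 1), coeffNormSq (orthonormalPoly β j) =
      ∑ k ∈ Finset.range (N + 1), ∑ j ∈ Finset.range (N + 1),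
        (orthonormalPoly β j).coeff k ^ 2 := by
    rw [Finset.sum_comm]
    refine Finset.sum_congr rfl fun j hj => ?_
    exact coeffNormSq_eq_sum_range
      ((natDegree_orthonormalPoly_le β j).trans (Nat.lt_succ_iff.1 (Finset.mem_range.1 hj)))
  rw [coeffNormSq_eq_sum_range hp, h1, hin, Finset.mul_sum]
  refine Finset.sum_le_sum fun k _ => ?_
  rw [hcoeff]
  exact Finset.sum_mul_sq_le_sq_mul_sq _ _ _

/-- As `K_jj = 2π ∑_k b_jk²`, this says `2π ≤ λ_N ∑_{j ≤ N} K_jj`. -/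
theorem one_le_smallestEigenvalue_mul {β : ℝ} (hβ : 0 < β) (N : ℕ) :
    1 ≤ smallestEigenvalue β N *
      ∑ j ∈ Finset.range (N + 1), coeffNormSq (orthonormalPoly β j) := by
  obtain ⟨p, hp0, hdeg, hp⟩ := exists_inner_self_eq_smallestEigenvalue_mul hβ N
  have h := coeffNormSq_le hβ hdeg
  rw [hp] at h
  have hpos := coeffNormSq_pos hp0
  refine le_of_mul_le_mul_right ?_ hpos
  linarith

/-- If the series of the `K_jj` converges, its sum bounds all the `λ_N` from below. -/
theorem two_pi_div_tsum_le_smallestEigenvalue {β : ℝ} (hβ : 0 < β)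
    (hs : Summable fun j => coeffNormSq (orthonormalPoly β j)) (N : ℕ) :
    2 * Real.pi / (2 * Real.pi * ∑' j, coeffNormSq (orthonormalPoly β j)) ≤
      smallestEigenvalue β N := by
  have hle := hs.sum_le_tsum (Finset.range (N + 1)) fun j _ => coeffNormSq_nonneg _
  have h1 := one_le_smallestEigenvalue_mul hβ N
  have hpos := smallestEigenvalue_pos hβ N
  have h2 := h1.trans (mul_le_mul_of_nonneg_left hle hpos.le)
  have h3 : 0 < ∑' j, coeffNormSq (orthonormalPoly β j) := by
    by_contra h
    have := mul_nonpos_of_nonneg_of_nonpos hpos.le (not_lt.1 h)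
    linarith
  rw [div_le_iff₀ (by positivity)]
  nlinarith [Real.pi_pos]

/-! ### Convergence of the kernel for `β < 1/2` -/

theorem sum_coeff_mul_pow_sq_le {β : ℝ} (hβ : 0 < β) (hβ' : β < 1 / 2) {r : ℝ} (hr : 0 ≤ r)
    (n : ℕ) :
    ∑ j ∈ Finset.range n, ∑ k ∈ (orthonormalPoly β j).support,
      ((orthonormalPoly β j).coeff k * r ^ k) ^ 2 ≤ 2 * evalBound β r := by
  have hπ : 0 < 2 * Real.pi := by have := Real.pi_pos; positivity
  refine le_of_mul_le_mul_left ?_ hπ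
  rw [Finset.mul_sum]
  simp only [← integral_sq_norm_aeval_circle]
  have hcont : ∀ j, Continuous fun φ : ℝ =>
      ‖aeval (r * Complex.exp (φ * Complex.I)) (orthonormalPoly β j)‖ ^ 2 := fun j =>
    ((orthonormalPoly β j).continuous_aeval.comp (by fun_prop)).norm.pow 2
  rw [← intervalIntegral.integral_finsetSum fun j _ => (hcont j).intervalIntegrable _ _]
  have h := intervalIntegral.integral_mono_on (μ := volume) hπ.le
    ((continuous_finsetSum (Finset.range n) fun j _ => hcont j).intervalIntegrable 0
      (2 * Real.pi))
    (continuous_const.intervalIntegrable 0 (2 * Real.pi)) fun φ _ =>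
      sum_sq_norm_orthonormalEval_le hβ hβ' n (r := r)
        (z := r * Complex.exp (φ * Complex.I)) (by
          rw [norm_mul, Complex.norm_exp_ofReal_mul_I, Complex.norm_real, mul_one,
            Real.norm_of_nonneg hr])
  rw [intervalIntegral.integral_const, sub_zero, smul_eq_mul] at h
  exact h

theorem summable_sum_coeff_mul_pow_sq {β : ℝ} (hβ : 0 < β) (hβ' : β < 1 / 2) {r : ℝ}
    (hr : 0 ≤ r) :
    Summable fun j => ∑ k ∈ (orthonormalPoly β j).support,
      ((orthonormalPoly β j).coeff k * r ^ k) ^ 2 :=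
  summable_of_sum_range_le (fun _ => Finset.sum_nonneg fun _ _ => sq_nonneg _)
    (sum_coeff_mul_pow_sq_le hβ hβ' hr)

theorem summable_coeffNormSq {β : ℝ} (hβ : 0 < β) (hβ' : β < 1 / 2) :
    Summable fun j => coeffNormSq (orthonormalPoly β j) := by
  simpa [coeffNormSq] using summable_sum_coeff_mul_pow_sq hβ hβ' zero_le_one

theorem sum_geometric_quarter_le (s : Finset ℕ) : ∑ k ∈ s, (1 / 4 : ℝ) ^ k ≤ 4 / 3 := by
  have h := (summable_geometric_of_lt_one (r := (1 / 4 : ℝ)) (by norm_num)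
    (by norm_num)).sum_le_tsum s fun k _ => by positivity
  rw [tsum_geometric_of_lt_one (by norm_num) (by norm_num)] at h
  norm_num at h ⊢
  exact h

/-- On the disc of half the radius, a polynomial is controlled by its mean square over a circle. -/
theorem sq_norm_aeval_le_sum (p : ℝ[X]) {r : ℝ} {z : ℂ} (hz : 2 * ‖z‖ ≤ r) :
    ‖aeval z p‖ ^ 2 ≤ (∑ k ∈ p.support, (p.coeff k * r ^ k) ^ 2) * (4 / 3) := by
  have hterm : ∀ k, ‖p.coeff k • z ^ k‖ ≤ |p.coeff k * r ^ k| * (1 / 2) ^ k := fun k => by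
    have hr : 0 ≤ r := by linarith [norm_nonneg z]
    rw [norm_smul, norm_pow, Real.norm_eq_abs, abs_mul, abs_of_nonneg (pow_nonneg hr k), mul_assoc,
      ← mul_pow]
    exact mul_le_mul_of_nonneg_left (pow_le_pow_left₀ (norm_nonneg z) (by linarith) k)
      (abs_nonneg _)
  have h1 : ‖aeval z p‖ ≤ ∑ k ∈ p.support, |p.coeff k * r ^ k| * (1 / 2) ^ k := by
    rw [aeval_eq_sum_support]
    exact (norm_sum_le _ _).trans (Finset.sum_le_sum fun k _ => hterm k)
  have h2 := Finset.sum_mul_sq_le_sq_mul_sq p.support (fun k => |p.coeff k * r ^ k|)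
    fun k => (1 / 2 : ℝ) ^ k
  refine (pow_le_pow_left₀ (norm_nonneg _) h1 2).trans (h2.trans ?_)
  simp only [sq_abs, ← pow_mul, mul_comm _ 2]
  simp only [pow_mul]
  refine mul_le_mul_of_nonneg_left ?_ (Finset.sum_nonneg fun k _ => sq_nonneg _)
  have := sum_geometric_quarter_le p.support
  norm_num at this ⊢
  exact this

theorem summable_sq_norm_orthonormalEval {β : ℝ} (hβ : 0 < β) (hβ' : β < 1 / 2) (z : ℂ) :
    Summable fun j : ℕ => ‖orthonormalEval β j z‖ ^ 2 :=
  Summable.of_nonneg_of_le (fun _ => sq_nonneg _)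
    (fun j => sq_norm_aeval_le_sum (orthonormalPoly β j) le_rfl)
    ((summable_sum_coeff_mul_pow_sq hβ hβ' (by positivity)).mul_right _)

theorem tendstoLocallyUniformly_sum_orthonormalEval {β : ℝ} (hβ : 0 < β) (hβ' : β < 1 / 2) :
    TendstoLocallyUniformly
      (fun (n : ℕ) (z : ℂ) => ∑ j ∈ Finset.range n, ‖orthonormalEval β j z‖ ^ 2)
      (fun z : ℂ => ∑' j : ℕ, ‖orthonormalEval β j z‖ ^ 2) Filter.atTop := by
  rw [tendstoLocallyUniformly_iff_forall_isCompact]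
  intro K hK
  obtain ⟨r, hr⟩ := hK.isBounded.exists_norm_le
  refine tendstoUniformlyOn_tsum_nat
    ((summable_sum_coeff_mul_pow_sq hβ hβ' (r := 2 * |r|) (by positivity)).mul_right (4 / 3))
    fun j z hz => ?_
  rw [Real.norm_of_nonneg (sq_nonneg _)]
  exact sq_norm_aeval_le_sum _ (by linarith [hr z hz, le_abs_self r])

/-! ### Complex polynomials -/

theorem exists_eval_eq_aeval_add (p : ℂ[X]) :
    ∃ u v : ℝ[X], ∀ z : ℂ, p.eval z = aeval z u + Complex.I * aeval z v := by
  induction p using Polynomial.induction_on' with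
  | add p q hp hq =>
    obtain ⟨u, v, h⟩ := hp
    obtain ⟨u', v', h'⟩ := hq
    refine ⟨u + u', v + v', fun z => ?_⟩
    rw [eval_add, h, h', map_add, map_add]
    ring
  | monomial n c =>
    refine ⟨monomial n c.re, monomial n c.im, fun z => ?_⟩
    simp only [eval_monomial, aeval_monomial, Complex.coe_algebraMap]
    conv_lhs => rw [← Complex.re_add_im c]
    ring

theorem aeval_ofReal_eq (u : ℝ[X]) (x : ℝ) : aeval (x : ℂ) u = ((u.eval x : ℝ) : ℂ) := by
  rw [← Complex.coe_algebraMap, aeval_algebraMap_apply, coe_aeval_eq_eval]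

theorem sq_norm_eval_eq {p : ℂ[X]} {u v : ℝ[X]}
    (h : ∀ z : ℂ, p.eval z = aeval z u + Complex.I * aeval z v) (x : ℝ) :
    ‖p.eval (x : ℂ)‖ ^ 2 = (u * u).eval x + (v * v).eval x := by
  rw [h, aeval_ofReal_eq, aeval_ofReal_eq, Complex.sq_norm, Complex.normSq_apply]
  simp

theorem integrable_sq_norm_eval {ν : Measure ℝ}
    (hν : ∀ n : ℕ, Integrable (fun x : ℝ => x ^ n) ν) (p : ℂ[X]) :
    Integrable (fun x : ℝ => ‖p.eval (x : ℂ)‖ ^ 2) ν := by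
  obtain ⟨u, v, h⟩ := exists_eval_eq_aeval_add p
  simp only [sq_norm_eval_eq h]
  exact (integrable_eval hν _).add (integrable_eval hν _)

theorem integral_sq_norm_eval {ν : Measure ℝ}
    (hν : ∀ n : ℕ, Integrable (fun x : ℝ => x ^ n) ν) {p : ℂ[X]} {u v : ℝ[X]}
    (h : ∀ z : ℂ, p.eval z = aeval z u + Complex.I * aeval z v) :
    ∫ x, ‖p.eval (x : ℂ)‖ ^ 2 ∂ν = ∫ x, (u * u).eval x ∂ν + ∫ x, (v * v).eval x ∂ν := by
  simp only [sq_norm_eval_eq h]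
  exact integral_add (integrable_eval hν _) (integrable_eval hν _)

theorem integrable_eval_complex {ν : Measure ℝ}
    (hν : ∀ n : ℕ, Integrable (fun x : ℝ => x ^ n) ν) (p : ℂ[X]) :
    Integrable (fun x : ℝ => p.eval (x : ℂ)) ν := by
  obtain ⟨u, v, h⟩ := exists_eval_eq_aeval_add p
  simp only [h, aeval_ofReal_eq]
  exact (integrable_eval hν u).ofReal.add ((integrable_eval hν v).ofReal.const_mul _)

theorem integral_eval_complex_congr {ν ν' : Measure ℝ}
    (h : ∀ n : ℕ, Integrable (fun x : ℝ => x ^ n) ν)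
    (h' : ∀ n : ℕ, Integrable (fun x : ℝ => x ^ n) ν')
    (heq : ∀ n : ℕ, ∫ x, x ^ n ∂ν = ∫ x, x ^ n ∂ν') (p : ℂ[X]) :
    ∫ x : ℝ, p.eval (x : ℂ) ∂ν = ∫ x : ℝ, p.eval (x : ℂ) ∂ν' := by
  obtain ⟨u, v, huv⟩ := exists_eval_eq_aeval_add p
  simp only [huv, aeval_ofReal_eq]
  rw [integral_add (integrable_eval h u).ofReal ((integrable_eval h v).ofReal.const_mul _),
    integral_add (integrable_eval h' u).ofReal ((integrable_eval h' v).ofReal.const_mul _),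
    integral_const_mul, integral_const_mul, integral_complex_ofReal, integral_complex_ofReal,
    integral_complex_ofReal, integral_complex_ofReal,
    integral_eval_congr h h' heq, integral_eval_congr h h' heq]

/-! ### Unbounded point evaluations for `β > 1/2` -/

theorem integrable_exp_mul_sqrt {β : ℝ} (hβ : 1 / 2 < β) {a : ℝ} (ha : 0 < a) :
    Integrable (fun x : ℝ => Real.exp (a * Real.sqrt x)) (weightMeasure β) := by
  have hβ0 : 0 < β := by linarith
  have hγ : 0 < 2 * β - 1 := by linarith
  set T := (2 * a) ^ (2 * β - 1)⁻¹ with hT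
  have hT0 : 0 ≤ T := by positivity
  -- Beyond `√x = T` half of `x^β` absorbs `a √x`; before it, `a √x` is at most `a T`.
  have hkey : ∀ x : ℝ, 0 < x → a * Real.sqrt x ≤ a * T + 1 / 2 * x ^ β := fun x hx => by
    have hxβ : 0 < x ^ β := Real.rpow_pos_of_pos hx β
    rcases le_total (Real.sqrt x) T with h | h
    · have := mul_le_mul_of_nonneg_left h ha.le
      linarith
    · have hs : 0 < Real.sqrt x := Real.sqrt_pos.2 hx
      have h1 : 2 * a ≤ Real.sqrt x ^ (2 * β - 1) := by
        have := Real.rpow_le_rpow hT0 h hγ.le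
        rwa [hT, Real.rpow_inv_rpow (by positivity) hγ.ne'] at this
      have h2 : x ^ β = Real.sqrt x ^ (2 * β - 1) * Real.sqrt x := by
        rw [← Real.rpow_add_one hs.ne', sub_add_cancel, Real.rpow_mul hs.le, Real.rpow_two,
          Real.sq_sqrt hx.le]
      have h3 := mul_le_mul_of_nonneg_right h1 hs.le
      have h4 : 0 ≤ a * T := by positivity
      linarith
  have hint : Integrable (fun x : ℝ => Real.exp (a * T) *
      (x ^ (0 : ℝ) * Real.exp (-(1 / 2) * x ^ β))) (volume.restrict (Ioi 0)) := by
    refine Integrable.const_mul (Integrable.of_integral_ne_zero ?_) _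
    rw [integral_rpow_mul_exp_neg_mul_rpow hβ0 (by norm_num) (by norm_num)]
    have : 0 < Real.Gamma ((0 + 1) / β) := Real.Gamma_pos_of_pos (by positivity)
    positivity
  rw [integrable_weightMeasure_iff]
  refine hint.mono' (by fun_prop) ?_
  filter_upwards [ae_restrict_mem measurableSet_Ioi] with x hx
  rw [smul_eq_mul, weight, ← Real.exp_add, Real.rpow_zero, one_mul, ← Real.exp_add,
    Real.norm_of_nonneg (Real.exp_pos _).le]
  refine Real.exp_le_exp.2 ?_
  linarith [hkey x hx]

/-- The Taylor polynomials in `x = y²` of `exp(-bS) (cos(Sy) - (y/b) sin(Sy))`, an entire function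
of `y²` which is `1` at `y² = -b²`. -/
noncomputable def testPoly (b : ℂ) (S : ℝ) (N : ℕ) : ℂ[X] :=
  C (Complex.exp (-b * S)) * ∑ n ∈ Finset.range N,
    (C ((-1) ^ n * (S : ℂ) ^ (2 * n) / (2 * n).factorial) * X ^ n -
      C (b⁻¹ * ((-1) ^ n * (S : ℂ) ^ (2 * n + 1) / (2 * n + 1).factorial)) * X ^ (n + 1))

theorem eval_testPoly (b : ℂ) (S : ℝ) (N : ℕ) (y : ℂ) :
    (testPoly b S N).eval (y ^ 2) = Complex.exp (-b * S) * ∑ n ∈ Finset.range N,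
      ((-1) ^ n * (S * y) ^ (2 * n) / (2 * n).factorial -
        b⁻¹ * y * ((-1) ^ n * (S * y) ^ (2 * n + 1) / (2 * n + 1).factorial)) := by
  simp only [testPoly, eval_mul, eval_C, eval_finsetSum, eval_sub, eval_pow, eval_X]
  congr 1
  refine Finset.sum_congr rfl fun n _ => ?_
  rw [← pow_mul, ← pow_mul, mul_pow, mul_pow]
  ring

theorem tendsto_eval_testPoly (b : ℂ) (S : ℝ) (y : ℂ) :
    Filter.Tendsto (fun N => (testPoly b S N).eval (y ^ 2)) Filter.atTop
      (nhds (Complex.exp (-b * S) * (Complex.cos (S * y) - b⁻¹ * y * Complex.sin (S * y)))) := by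
  simp only [eval_testPoly]
  exact (((Complex.hasSum_cos (S * y)).sub
    ((Complex.hasSum_sin (S * y)).mul_left (b⁻¹ * y))).tendsto_sum_nat).const_mul _

theorem norm_eval_testPoly_le {b : ℂ} (hb : 0 < b.re) {S y : ℝ} (hS : 0 ≤ S) (hy : 0 ≤ y) (N : ℕ) :
    ‖(testPoly b S N).eval ((y : ℂ) ^ 2)‖ ≤ Real.exp ((S + ‖b‖⁻¹) * y) := by
  have hSy : 0 ≤ S * y := mul_nonneg hS hy
  have h1 : ‖Complex.exp (-b * S)‖ ≤ 1 := by
    rw [Complex.norm_exp, Real.exp_le_one_iff, Complex.re_mul_ofReal, Complex.neg_re]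
    nlinarith
  have hsinh : 0 ≤ Real.sinh (S * y) := Real.sinh_nonneg_iff.2 hSy
  have hcosh : 0 < Real.cosh (S * y) := Real.cosh_pos _
  have hadd := Real.cosh_add_sinh (S * y)
  have hc := sum_le_hasSum (Finset.range N) (fun n _ => by positivity) (Real.hasSum_cosh (S * y))
  have hs := sum_le_hasSum (Finset.range N) (fun n _ => by positivity) (Real.hasSum_sinh (S * y))
  have hsum : ‖∑ n ∈ Finset.range N, ((-1 : ℂ) ^ n * (S * y) ^ (2 * n) / (2 * n).factorial -
        b⁻¹ * y * ((-1) ^ n * (S * y) ^ (2 * n + 1) / (2 * n + 1).factorial))‖ ≤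
      ∑ n ∈ Finset.range N, (S * y) ^ (2 * n) / (2 * n).factorial + ‖b‖⁻¹ * y *
        ∑ n ∈ Finset.range N, (S * y) ^ (2 * n + 1) / (2 * n + 1).factorial := by
    rw [Finset.mul_sum, ← Finset.sum_add_distrib]
    refine (norm_sum_le _ _).trans (Finset.sum_le_sum fun n _ => (norm_sub_le _ _).trans ?_)
    simp only [norm_mul, norm_div, norm_pow, norm_neg, norm_one, one_pow, one_mul, norm_inv,
      Complex.norm_real, Complex.norm_natCast, Real.norm_of_nonneg hS, Real.norm_of_nonneg hy]
    exact le_rfl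
  have hby : 0 ≤ ‖b‖⁻¹ * y := by positivity
  rw [eval_testPoly, norm_mul]
  calc ‖Complex.exp (-b * S)‖ * ‖_‖ ≤ 1 * (Real.exp (S * y) + ‖b‖⁻¹ * y * Real.exp (S * y)) := by
        refine mul_le_mul h1 (hsum.trans ?_) (norm_nonneg _) zero_le_one
        exact add_le_add (by linarith) (mul_le_mul_of_nonneg_left (by linarith) hby)
    _ = (‖b‖⁻¹ * y + 1) * Real.exp (S * y) := by ring
    _ ≤ Real.exp (‖b‖⁻¹ * y) * Real.exp (S * y) :=
        mul_le_mul_of_nonneg_right (Real.add_one_le_exp _) (Real.exp_pos _).le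
    _ = Real.exp ((S + ‖b‖⁻¹) * y) := by rw [← Real.exp_add]; ring_nf

/-- For `β > 1/2` the value of a polynomial at `-b²`, a point off `[0, ∞)`, is not controlled by
its `L²` norm. -/
theorem exists_eval_eq_one_integral_lt {β : ℝ} (hβ : 1 / 2 < β) {b : ℂ} (hb : 0 < b.re) {ε : ℝ}
    (hε : 0 < ε) :
    ∃ p : ℂ[X], p.eval (-b ^ 2) = 1 ∧ ∫ x : ℝ, ‖p.eval (x : ℂ)‖ ^ 2 ∂weightMeasure β < ε := by
  have hb0 : b ≠ 0 := fun h => by simp [h] at hb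
  have hbn : 0 < ‖b‖⁻¹ := inv_pos.2 (norm_pos_iff.2 hb0)
  have hsqexp : ∀ t : ℝ, Real.exp t ^ 2 = Real.exp (2 * t) := fun t => by
    rw [← Real.exp_nat_mul]; norm_num
  set g : ℝ → ℝ → ℂ := fun S x => Complex.exp (-b * S) * (Complex.cos (S * Real.sqrt x) -
    b⁻¹ * Real.sqrt x * Complex.sin (S * Real.sqrt x)) with hg
  set K := ∫ x : ℝ, Real.exp (2 * ‖b‖⁻¹ * Real.sqrt x) ∂weightMeasure β with hK
  have hKint := integrable_exp_mul_sqrt hβ (a := 2 * ‖b‖⁻¹) (by positivity)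
  have hgle : ∀ S x, ‖g S x‖ ^ 2 ≤
      Real.exp (-(2 * b.re) * S) * Real.exp (2 * ‖b‖⁻¹ * Real.sqrt x) := fun S x => by
    have h1 : ‖g S x‖ ≤ Real.exp (-b.re * S) * Real.exp (‖b‖⁻¹ * Real.sqrt x) := by
      rw [hg, norm_mul, Complex.norm_exp, Complex.re_mul_ofReal, Complex.neg_re]
      refine mul_le_mul_of_nonneg_left ?_ (Real.exp_pos _).le
      refine (norm_sub_le _ _).trans ?_
      rw [← Complex.ofReal_mul, ← Complex.ofReal_cos, ← Complex.ofReal_sin, norm_mul, norm_mul,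
        norm_inv, Complex.norm_real, Complex.norm_real, Complex.norm_real, Real.norm_eq_abs,
        Real.norm_of_nonneg (Real.sqrt_nonneg x), Real.norm_eq_abs]
      have h2 : ‖b‖⁻¹ * Real.sqrt x * |Real.sin (S * Real.sqrt x)| ≤ ‖b‖⁻¹ * Real.sqrt x :=
        mul_le_of_le_one_right (by positivity) (Real.abs_sin_le_one _)
      have h3 := Real.abs_cos_le_one (S * Real.sqrt x)
      have h4 := Real.add_one_le_exp (‖b‖⁻¹ * Real.sqrt x)
      linarith
    refine (pow_le_pow_left₀ (norm_nonneg _) h1 2).trans (le_of_eq ?_)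
    rw [mul_pow, hsqexp, hsqexp]
    ring_nf
  -- The limit functions have small norm once `S` is large.
  obtain ⟨S, hS0, hS⟩ : ∃ S : ℝ, 0 ≤ S ∧ Real.exp (-(2 * b.re) * S) * K < ε := by
    have h1 : Filter.Tendsto (fun S : ℝ => Real.exp (-(2 * b.re) * S) * K) Filter.atTop
        (nhds 0) := by
      have h2 := (Real.tendsto_exp_atBot.comp
        (Filter.tendsto_id.const_mul_atTop_of_neg (show -(2 * b.re) < 0 by linarith))).mul_const K
      rw [zero_mul] at h2
      exact h2
    obtain ⟨S, h3, h4⟩ := ((h1.eventually_lt_const hε).and (Filter.eventually_ge_atTop 0)).exists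
    exact ⟨S, h4, h3⟩
  have hlim : Filter.Tendsto
      (fun N => ∫ x : ℝ, ‖(testPoly b S N).eval (x : ℂ)‖ ^ 2 ∂weightMeasure β) Filter.atTop
      (nhds (∫ x : ℝ, ‖g S x‖ ^ 2 ∂weightMeasure β)) := by
    refine tendsto_integral_of_dominated_convergence
      (fun x => Real.exp (2 * (S + ‖b‖⁻¹) * Real.sqrt x)) (fun N => ?_)
      (integrable_exp_mul_sqrt hβ (by positivity)) (fun N => ?_) ?_
    · exact (((testPoly b S N).continuous.comp Complex.continuous_ofReal).norm.pow
        2).aestronglyMeasurable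
    · filter_upwards [ae_weightMeasure_pos β] with x hx
      have h1 := norm_eval_testPoly_le hb hS0 (Real.sqrt_nonneg x) N
      rw [← Complex.ofReal_pow, Real.sq_sqrt hx.le] at h1
      rw [Real.norm_of_nonneg (sq_nonneg _)]
      refine (pow_le_pow_left₀ (norm_nonneg _) h1 2).trans (le_of_eq ?_)
      rw [hsqexp, mul_assoc]
    · filter_upwards [ae_weightMeasure_pos β] with x hx
      have h1 := tendsto_eval_testPoly b S (Real.sqrt x)
      rw [← Complex.ofReal_pow, Real.sq_sqrt hx.le] at h1
      exact h1.norm.pow 2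
  have hglt : ∫ x : ℝ, ‖g S x‖ ^ 2 ∂weightMeasure β < ε := by
    refine lt_of_le_of_lt ?_ hS
    rw [hK, ← integral_const_mul]
    exact integral_mono_of_nonneg (Filter.Eventually.of_forall fun x => sq_nonneg _)
      (hKint.const_mul _) (Filter.Eventually.of_forall (hgle S))
  -- At `y = ib` the limit is `exp(-bS) exp(bS)`.
  have hone : Filter.Tendsto (fun N => (testPoly b S N).eval (-b ^ 2)) Filter.atTop
      (nhds 1) := by
    have h1 := tendsto_eval_testPoly b S (Complex.I * b)
    have h2 : (Complex.I * b) ^ 2 = -b ^ 2 := by rw [mul_pow, Complex.I_sq]; ring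
    have h3 : Complex.exp (-b * S) * (Complex.cos (S * (Complex.I * b)) -
        b⁻¹ * (Complex.I * b) * Complex.sin (S * (Complex.I * b))) = 1 := by
      have h4 : b⁻¹ * (Complex.I * b) = Complex.I := by field_simp
      have h5 : Complex.cos (S * (Complex.I * b)) -
          Complex.I * Complex.sin (S * (Complex.I * b)) = Complex.exp (b * S) := by
        have h6 := Complex.exp_mul_I (-(S * (Complex.I * b)))
        rw [Complex.cos_neg, Complex.sin_neg] at h6
        have h7 : -((S : ℂ) * (Complex.I * b)) * Complex.I = b * S := by
          linear_combination (-(S : ℂ) * b) * Complex.I_sq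
        rw [h7] at h6
        rw [h6]; ring
      rw [h4, h5, ← Complex.exp_add, neg_mul, neg_add_cancel, Complex.exp_zero]
    rwa [h2, h3] at h1
  have hquot : Filter.Tendsto (fun N =>
      (‖(testPoly b S N).eval (-b ^ 2)‖⁻¹) ^ 2 *
        ∫ x : ℝ, ‖(testPoly b S N).eval (x : ℂ)‖ ^ 2 ∂weightMeasure β) Filter.atTop
      (nhds (∫ x : ℝ, ‖g S x‖ ^ 2 ∂weightMeasure β)) := by
    have h1 := ((hone.norm.inv₀ (by simp)).pow 2).mul hlim
    simpa using h1
  obtain ⟨N, hN, hN0⟩ := ((hquot.eventually_lt_const hglt).and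
    (hone.eventually_ne one_ne_zero)).exists
  refine ⟨C ((testPoly b S N).eval (-b ^ 2))⁻¹ * testPoly b S N, ?_, ?_⟩
  · rw [eval_C_mul, inv_mul_cancel₀ hN0]
  · simp only [eval_C_mul, norm_mul, mul_pow, norm_inv]
    rw [integral_const_mul]
    exact hN

/-- The squared coefficients of a polynomial with value `1` at the point `-1/4` of the unit disc
have a sum bounded away from `0`, while its `L²` norm can be arbitrarily small. -/
theorem iInf_smallestEigenvalue_eq_zero {β : ℝ} (hβ : 1 / 2 < β) :
    ⨅ N, smallestEigenvalue β N = 0 := by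
  have hβ0 : 0 < β := by linarith
  have hnn : 0 ≤ ⨅ N, smallestEigenvalue β N :=
    le_ciInf fun N => (smallestEigenvalue_pos hβ0 N).le
  refine le_antisymm (le_of_forall_pos_le_add fun ε hε => ?_) hnn
  rw [zero_add]
  set m := ⨅ N, smallestEigenvalue β N with hm
  obtain ⟨p, hp1, hp⟩ := exists_eval_eq_one_integral_lt hβ (b := 1 / 2) (by norm_num)
    (show 0 < ε * (3 / 8) by positivity)
  obtain ⟨u, v, h⟩ := exists_eval_eq_aeval_add p
  rw [integral_sq_norm_eval (integrable_pow_weightMeasure hβ0) h, ← inner_eq_integral,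
    ← inner_eq_integral] at hp
  have hle : ∀ q : ℝ[X], m * coeffNormSq q ≤ inner β q q := fun q =>
    (mul_le_mul_of_nonneg_right (ciInf_le (bddBelow_smallestEigenvalue hβ0) q.natDegree)
      (coeffNormSq_nonneg q)).trans (smallestEigenvalue_mul_le hβ0 le_rfl)
  have hz : 2 * ‖(-(1 / 2) ^ 2 : ℂ)‖ ≤ 1 := by norm_num
  have hu := sq_norm_aeval_le_sum u hz
  have hv := sq_norm_aeval_le_sum v hz
  simp only [one_pow, mul_one] at hu hv
  rw [← coeffNormSq] at hu hv
  rw [h] at hp1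
  have h1 : 1 ≤ ‖aeval (-(1 / 2) ^ 2 : ℂ) u‖ + ‖aeval (-(1 / 2) ^ 2 : ℂ) v‖ := by
    have := norm_add_le (aeval (-(1 / 2) ^ 2 : ℂ) u)
      (Complex.I * aeval (-(1 / 2) ^ 2 : ℂ) v)
    rwa [hp1, norm_one, norm_mul, Complex.norm_I, one_mul] at this
  have h2 : 3 / 8 ≤ coeffNormSq u + coeffNormSq v := by
    nlinarith [sq_nonneg (‖aeval (-(1 / 2) ^ 2 : ℂ) u‖ - ‖aeval (-(1 / 2) ^ 2 : ℂ) v‖)]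
  have h3 := mul_le_mul_of_nonneg_left h2 hnn
  have h4 := hle u
  have h5 := hle v
  linarith

/-! ### Determinacy for `β > 1/2` -/

/-- `f` lies in the closure of the polynomials in `L²(κ)`. The integrals are meaningful when `κ` has
moments of all orders, which is assumed wherever the notion is used. -/
def PolyApprox (κ : Measure ℝ) (f : ℝ →ᵇ ℂ) : Prop :=
  ∀ ε > 0, ∃ q : ℂ[X], ∫ x : ℝ, ‖f x - q.eval (x : ℂ)‖ ^ 2 ∂κ < ε

theorem sq_norm_add_le {E : Type*} [SeminormedAddCommGroup E] (a b : E) :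
    ‖a + b‖ ^ 2 ≤ 2 * ‖a‖ ^ 2 + 2 * ‖b‖ ^ 2 := by
  have := norm_add_le a b
  nlinarith [norm_nonneg (a + b), sq_nonneg (‖a‖ - ‖b‖)]

theorem integrable_sq_norm_sub_eval {κ : Measure ℝ}
    (hκ : ∀ n : ℕ, Integrable (fun x : ℝ => x ^ n) κ) (f : ℝ →ᵇ ℂ) (q : ℂ[X]) :
    Integrable (fun x : ℝ => ‖f x - q.eval (x : ℂ)‖ ^ 2) κ := by
  have := isFiniteMeasure_of_integrable_pow hκ
  have hcont : Continuous fun x : ℝ => ‖f x - q.eval (x : ℂ)‖ ^ 2 :=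
    (f.continuous.sub (q.continuous.comp Complex.continuous_ofReal)).norm.pow 2
  refine ((integrable_const (2 * ‖f‖ ^ 2)).add ((integrable_sq_norm_eval hκ q).const_mul 2)).mono'
    hcont.aestronglyMeasurable (Filter.Eventually.of_forall fun x => ?_)
  rw [Real.norm_of_nonneg (sq_nonneg _), sub_eq_add_neg]
  refine (sq_norm_add_le _ _).trans ?_
  rw [norm_neg]
  have := pow_le_pow_left₀ (norm_nonneg _) (f.norm_coe_le_norm x) 2
  simp only [Pi.add_apply]
  linarith

/-- The bounded continuous functions multiplying the `L²(κ)`-closure of the polynomials into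
itself. -/
def multiplierAlgebra {κ : Measure ℝ} (hκ : ∀ n : ℕ, Integrable (fun x : ℝ => x ^ n) κ) :
    StarSubalgebra ℂ (ℝ →ᵇ ℂ) where
  carrier := {a | ∀ f, PolyApprox κ f → PolyApprox κ (a * f)}
  mul_mem' {a b} ha hb f hf := by rw [mul_assoc]; exact ha _ (hb f hf)
  add_mem' {a b} ha hb f hf ε hε := by
    obtain ⟨q, hq⟩ := ha f hf (ε / 4) (by positivity)
    obtain ⟨r, hr⟩ := hb f hf (ε / 4) (by positivity)
    refine ⟨q + r, ?_⟩
    have hqi := integrable_sq_norm_sub_eval hκ (a * f) q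
    have hri := integrable_sq_norm_sub_eval hκ (b * f) r
    have h := integral_mono (integrable_sq_norm_sub_eval hκ ((a + b) * f) (q + r))
      ((hqi.const_mul 2).add (hri.const_mul 2)) fun x => by
        have h1 : ((a + b) * f) x - (q + r).eval (x : ℂ) =
            ((a * f) x - q.eval (x : ℂ)) + ((b * f) x - r.eval (x : ℂ)) := by
          simp only [BoundedContinuousFunction.coe_mul, BoundedContinuousFunction.coe_add,
            Pi.mul_apply, Pi.add_apply, eval_add]
          ring
        simp only [h1]
        exact sq_norm_add_le _ _
    refine h.trans_lt ?_
    simp only [Pi.add_apply]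
    rw [integral_add (hqi.const_mul 2) (hri.const_mul 2), integral_const_mul, integral_const_mul]
    linarith
  algebraMap_mem' c f hf ε hε := by
    obtain ⟨q, hq⟩ := hf (ε / (‖c‖ ^ 2 + 1)) (by positivity)
    refine ⟨C c * q, ?_⟩
    have h1 : ∀ x : ℝ, ‖(algebraMap ℂ (ℝ →ᵇ ℂ) c * f) x - (C c * q).eval (x : ℂ)‖ ^ 2 =
        ‖c‖ ^ 2 * ‖f x - q.eval (x : ℂ)‖ ^ 2 := fun x => by
      rw [← mul_pow, ← norm_mul, eval_C_mul, mul_sub]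
      rfl
    simp only [h1]
    rw [integral_const_mul]
    rw [lt_div_iff₀ (by positivity)] at hq
    have : 0 ≤ ∫ x : ℝ, ‖f x - q.eval (x : ℂ)‖ ^ 2 ∂κ := integral_nonneg fun x => sq_nonneg _
    nlinarith
  star_mem' {a} ha f hf ε hε := by
    have hstar : ∀ g, PolyApprox κ g → PolyApprox κ (star g) := fun g hg ε hε => by
      obtain ⟨q, hq⟩ := hg ε hε
      refine ⟨q.map (starRingEnd ℂ), ?_⟩
      have h1 : ∀ x : ℝ, ‖(star g) x - (q.map (starRingEnd ℂ)).eval (x : ℂ)‖ =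
          ‖g x - q.eval (x : ℂ)‖ := fun x => by
        have h2 := eval_map_apply (f := starRingEnd ℂ) (p := q) (x : ℂ)
        rw [Complex.conj_ofReal] at h2
        rw [h2, ← Complex.norm_conj (g x - q.eval (x : ℂ)), map_sub]
        rfl
      simpa only [h1] using hq
    have h := hstar _ (ha _ (hstar f hf))
    rw [star_mul, star_star, mul_comm] at h
    exact h ε hε

/-- The bounded continuous function `x ↦ 1 / (x - w)` for nonreal `w`. -/
noncomputable def resolvent (w : ℂ) (hw : w.im ≠ 0) : ℝ →ᵇ ℂ :=
  BoundedContinuousFunction.ofNormedAddCommGroup (fun x : ℝ => ((x : ℂ) - w)⁻¹)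
    (Continuous.inv₀ (by fun_prop) fun x h => hw (by
      have := congrArg Complex.im h
      simpa using this)) |w.im|⁻¹ fun x => by
    rw [norm_inv]
    refine inv_anti₀ (abs_pos.2 hw) ?_
    have := Complex.abs_im_le_norm ((x : ℂ) - w)
    simpa using this

theorem resolvent_apply (w : ℂ) (hw : w.im ≠ 0) (x : ℝ) :
    resolvent w hw x = ((x : ℂ) - w)⁻¹ := rfl

/-- If the evaluation at `w` is unbounded on the polynomials in `L²(κ)`, then division by `x - w`
preserves their closure: modulo polynomials, `q / (x - w)` is `q(w) / (x - w)`, and `p(w) = 1` makes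
`1 / (x - w)` differ from a polynomial by `p / (x - w)`. -/
theorem resolvent_mem_multiplierAlgebra {κ : Measure ℝ}
    (hκ : ∀ n : ℕ, Integrable (fun x : ℝ => x ^ n) κ) {w : ℂ} (hw : w.im ≠ 0)
    (h : ∀ ε > 0, ∃ p : ℂ[X], p.eval w = 1 ∧ ∫ x : ℝ, ‖p.eval (x : ℂ)‖ ^ 2 ∂κ < ε) :
    resolvent w hw ∈ multiplierAlgebra hκ := by
  intro f hf ε hε
  set B := ‖resolvent w hw‖ ^ 2 with hB
  have hB0 : 0 ≤ B := sq_nonneg _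
  obtain ⟨q, hq⟩ := hf (ε / (4 * (B + 1))) (by positivity)
  set D := ‖q.eval w‖ ^ 2 * B with hD
  have hD0 : 0 ≤ D := mul_nonneg (sq_nonneg _) hB0
  obtain ⟨p, hp1, hp⟩ := h (ε / (4 * (D + 1))) (by positivity)
  obtain ⟨s, hs⟩ : X - C w ∣ 1 - p := by
    rw [dvd_iff_isRoot]
    simp [hp1]
  obtain ⟨t, ht⟩ : X - C w ∣ q - C (q.eval w) := by
    rw [dvd_iff_isRoot]
    simp
  refine ⟨t + C (q.eval w) * s, ?_⟩
  have hne : ∀ x : ℝ, (x : ℂ) - w ≠ 0 := fun x h => hw (by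
    have := congrArg Complex.im h
    simpa using this)
  have hid : ∀ x : ℝ, (resolvent w hw * f) x - (t + C (q.eval w) * s).eval (x : ℂ) =
      resolvent w hw x * (f x - q.eval (x : ℂ)) +
        q.eval w * (resolvent w hw x * p.eval (x : ℂ)) := fun x => by
    have h1 := congrArg (fun r => r.eval (x : ℂ)) hs
    have h2 := congrArg (fun r => r.eval (x : ℂ)) ht
    simp only [eval_sub, eval_one, eval_mul, eval_X, eval_C] at h1 h2
    simp only [BoundedContinuousFunction.coe_mul, Pi.mul_apply, resolvent_apply, eval_add,
      eval_mul, eval_C]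
    have h3 : t.eval (x : ℂ) = ((x : ℂ) - w)⁻¹ * (q.eval (x : ℂ) - q.eval w) := by
      rw [h2, inv_mul_cancel_left₀ (hne x)]
    have h4 : s.eval (x : ℂ) = ((x : ℂ) - w)⁻¹ * (1 - p.eval (x : ℂ)) := by
      rw [h1, inv_mul_cancel_left₀ (hne x)]
    rw [h3, h4]
    ring
  have hqi := (integrable_sq_norm_sub_eval hκ f q).const_mul (2 * B)
  have hpi := (integrable_sq_norm_eval hκ p).const_mul (2 * D)
  have hmono := integral_mono
    (integrable_sq_norm_sub_eval hκ (resolvent w hw * f) (t + C (q.eval w) * s))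
    (hqi.add hpi) fun x => by
      have hR : ‖resolvent w hw x‖ ^ 2 ≤ B :=
        pow_le_pow_left₀ (norm_nonneg _) ((resolvent w hw).norm_coe_le_norm x) 2
      simp only [hid, Pi.add_apply]
      refine (sq_norm_add_le _ _).trans ?_
      simp only [norm_mul, mul_pow, hD]
      have h1 := mul_le_mul_of_nonneg_right hR (sq_nonneg ‖f x - q.eval (x : ℂ)‖)
      have h2 := mul_le_mul_of_nonneg_left (mul_le_mul_of_nonneg_right hR
        (sq_nonneg ‖p.eval (x : ℂ)‖)) (sq_nonneg ‖q.eval w‖)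
      linarith
  refine hmono.trans_lt ?_
  simp only [Pi.add_apply]
  rw [integral_add hqi hpi, integral_const_mul, integral_const_mul]
  rw [lt_div_iff₀ (by positivity)] at hq hp
  have hq0 : 0 ≤ ∫ x : ℝ, ‖f x - q.eval (x : ℂ)‖ ^ 2 ∂κ := integral_nonneg fun x => sq_nonneg _
  have hp0 : 0 ≤ ∫ x : ℝ, ‖p.eval (x : ℂ)‖ ^ 2 ∂κ := integral_nonneg fun x => sq_nonneg _
  nlinarith

/-- The constant `1` is a polynomial, so a multiplier of the closure lies in the closure. -/
theorem multiplierAlgebra_le_polyApprox {κ : Measure ℝ}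
    (hκ : ∀ n : ℕ, Integrable (fun x : ℝ => x ^ n) κ) {a : ℝ →ᵇ ℂ}
    (ha : a ∈ multiplierAlgebra hκ) : PolyApprox κ a := by
  have h1 : PolyApprox κ 1 := fun ε hε => ⟨1, by simpa using hε⟩
  simpa using ha 1 h1

/-- Functions approximable in `L²(ν + ν')` have the same integral under `ν` and `ν'`, if all moments
of the two measures agree. -/
theorem PolyApprox.integral_eq {ν ν' : Measure ℝ} [IsFiniteMeasure ν] [IsFiniteMeasure ν']
    (h : ∀ n : ℕ, Integrable (fun x : ℝ => x ^ n) ν)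
    (h' : ∀ n : ℕ, Integrable (fun x : ℝ => x ^ n) ν')
    (heq : ∀ n : ℕ, ∫ x, x ^ n ∂ν = ∫ x, x ^ n ∂ν') {f : ℝ →ᵇ ℂ}
    (hf : PolyApprox (ν + ν') f) : ∫ x, f x ∂ν = ∫ x, f x ∂ν' := by
  have hκ : ∀ n : ℕ, Integrable (fun x : ℝ => x ^ n) (ν + ν') := fun n =>
    (h n).add_measure (h' n)
  set V := (ν + ν').real univ with hV
  have hV0 : 0 ≤ V := measureReal_nonneg
  rw [← sub_eq_zero, ← norm_le_zero_iff]
  refine le_of_forall_pos_le_add fun δ hδ => ?_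
  set η := δ / (V + 1) with hη
  have hη0 : 0 < η := by positivity
  obtain ⟨q, hq⟩ := hf (η ^ 2) (by positivity)
  have hfi : ∀ μ : Measure ℝ, IsFiniteMeasure μ → Integrable (fun x => f x) μ := fun μ _ =>
    f.integrable μ
  have hqν := integrable_eval_complex h q
  have hqν' := integrable_eval_complex h' q
  have hsub : Integrable (fun x => f x - q.eval (x : ℂ)) ν := (hfi ν inferInstance).sub hqν
  have hsub' : Integrable (fun x => f x - q.eval (x : ℂ)) ν' := (hfi ν' inferInstance).sub hqν'
  have h1 : ∫ x, f x ∂ν - ∫ x, f x ∂ν' =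
      ∫ x, (f x - q.eval (x : ℂ)) ∂ν - ∫ x, (f x - q.eval (x : ℂ)) ∂ν' := by
    rw [integral_sub (hfi ν inferInstance) hqν, integral_sub (hfi ν' inferInstance) hqν',
      integral_eval_complex_congr h h' heq q]
    ring
  have h2 : ‖∫ x, f x ∂ν - ∫ x, f x ∂ν'‖ ≤ ∫ x, ‖f x - q.eval (x : ℂ)‖ ∂(ν + ν') := by
    rw [h1, integral_add_measure hsub.norm hsub'.norm]
    exact (norm_sub_le _ _).trans (add_le_add (norm_integral_le_integral_norm _)
      (norm_integral_le_integral_norm _))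
  have hsqi := (integrable_sq_norm_sub_eval hκ f q).const_mul η⁻¹
  have h3 : ∫ x, ‖f x - q.eval (x : ℂ)‖ ∂(ν + ν') ≤
      ∫ x, (η + η⁻¹ * ‖f x - q.eval (x : ℂ)‖ ^ 2) ∂(ν + ν') := by
    refine integral_mono (hsub.norm.add_measure hsub'.norm) ((integrable_const η).add hsqi)
      fun x => ?_
    -- This is `(‖f x - q x‖ - η)² ≥ 0` divided by `η`.
    have h4 : η⁻¹ * η = 1 := inv_mul_cancel₀ hη0.ne'
    have h5 : 0 ≤ η⁻¹ * (‖f x - q.eval (x : ℂ)‖ - η) ^ 2 := by positivity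
    have h6 : η⁻¹ * (‖f x - q.eval (x : ℂ)‖ - η) ^ 2 =
        η⁻¹ * ‖f x - q.eval (x : ℂ)‖ ^ 2 - 2 * (η⁻¹ * η) * ‖f x - q.eval (x : ℂ)‖ +
          (η⁻¹ * η) * η := by ring
    rw [h6, h4] at h5
    change ‖f x - q.eval (x : ℂ)‖ ≤ η + η⁻¹ * ‖f x - q.eval (x : ℂ)‖ ^ 2
    linarith [norm_nonneg (f x - q.eval (x : ℂ))]
  have h7 : ∫ x, (η + η⁻¹ * ‖f x - q.eval (x : ℂ)‖ ^ 2) ∂(ν + ν') ≤ δ := by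
    rw [integral_add (integrable_const η) hsqi, integral_const, integral_const_mul, smul_eq_mul,
      ← hV]
    have h8 : η⁻¹ * ∫ x : ℝ, ‖f x - q.eval (x : ℂ)‖ ^ 2 ∂(ν + ν') ≤ η := by
      rw [inv_mul_le_iff₀ hη0]
      nlinarith
    have h9 : η * (V + 1) = δ := div_mul_cancel₀ _ (by positivity)
    linarith
  linarith

/-- A solution of a moment problem for which evaluation at some nonreal point is unbounded on the
polynomials is the only one. -/
theorem eq_of_moments_eq {ν ν' : Measure ℝ}
    (h : ∀ n : ℕ, Integrable (fun x : ℝ => x ^ n) ν)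
    (h' : ∀ n : ℕ, Integrable (fun x : ℝ => x ^ n) ν')
    (heq : ∀ n : ℕ, ∫ x, x ^ n ∂ν = ∫ x, x ^ n ∂ν') {w : ℂ} (hw : w.im ≠ 0)
    (hev : ∀ ε > 0, ∃ p : ℂ[X], p.eval w = 1 ∧ ∫ x : ℝ, ‖p.eval (x : ℂ)‖ ^ 2 ∂ν < ε) :
    ν = ν' := by
  have hκ : ∀ n : ℕ, Integrable (fun x : ℝ => x ^ n) (ν + ν') := fun n =>
    (h n).add_measure (h' n)
  have := isFiniteMeasure_of_integrable_pow h
  have := isFiniteMeasure_of_integrable_pow h'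
  have hmem : resolvent w hw ∈ multiplierAlgebra hκ := by
    refine resolvent_mem_multiplierAlgebra hκ hw fun ε hε => ?_
    obtain ⟨p, hp1, hp⟩ := hev (ε / 2) (by positivity)
    obtain ⟨u, v, huv⟩ := exists_eval_eq_aeval_add p
    refine ⟨p, hp1, ?_⟩
    rw [integral_add_measure (integrable_sq_norm_eval h p) (integrable_sq_norm_eval h' p),
      integral_sq_norm_eval h' huv, ← integral_eval_congr h h' heq, ← integral_eval_congr h h' heq,
      ← integral_sq_norm_eval h huv]
    linarith
  refine ext_of_forall_mem_subalgebra_integral_eq_of_pseudoEMetric_complete_countable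
    (A := multiplierAlgebra hκ) ?_
    fun g hg => (multiplierAlgebra_le_polyApprox hκ hg).integral_eq h h' heq
  intro x y hxy
  refine ⟨_, ⟨_, StarSubalgebra.mem_map.2 ⟨resolvent w hw, hmem, rfl⟩, rfl⟩, fun hxy' => hxy ?_⟩
  have h1 : ((x : ℂ) - w)⁻¹ = ((y : ℂ) - w)⁻¹ := hxy'
  exact Complex.ofReal_injective (sub_left_injective (inv_injective h1))

/-- Uniqueness on `ℝ` contains uniqueness on `[0, ∞)`; the nonreal point used is
`-(1 + i)² = -2i`. -/
theorem momentDeterminate {β : ℝ} (hβ : 1 / 2 < β) {S : Set ℝ} (hS : Ici 0 ⊆ S) :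
    MomentDeterminate S (moment β) := by
  have hβ0 : 0 < β := by linarith
  refine ⟨weightMeasure β, (isMomentSolution_weightMeasure hβ0).mono hS, fun ν hν => ?_⟩
  refine (eq_of_moments_eq (integrable_pow_weightMeasure hβ0) (fun n => (hν.2 n).1)
    (fun n => by rw [integral_pow_weightMeasure, (hν.2 n).2])
    (w := -(1 + Complex.I) ^ 2) ?_ fun ε hε =>
      exists_eval_eq_one_integral_lt hβ (by simp) hε).symm
  simp [sq]

theorem not_summable_circleKernel {β : ℝ} (hβ : 1 / 2 < β) :
    ¬ Summable fun j : ℕ => circleKernel β j j := by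
  have hβ0 : 0 < β := by linarith
  intro hs
  simp only [circleKernel_self, Complex.summable_ofReal] at hs
  rw [summable_mul_left_iff (by have := Real.pi_pos; positivity)] at hs
  set T := ∑' j, coeffNormSq (orthonormalPoly β j) with hT
  have h1 : ∀ N, 1 ≤ smallestEigenvalue β N * T := fun N =>
    (one_le_smallestEigenvalue_mul hβ0 N).trans (mul_le_mul_of_nonneg_left
      (hs.sum_le_tsum _ fun j _ => coeffNormSq_nonneg _) (smallestEigenvalue_pos hβ0 N).le)
  have h2 := (tendsto_smallestEigenvalue hβ0).mul_const T
  rw [iInf_smallestEigenvalue_eq_zero hβ, zero_mul] at h2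
  have := ge_of_tendsto' h2 h1
  linarith

end HankelTransition


open HankelTransition in
theorem mainTheorem3 :
    (∀ β : ℝ, 1 / 2 < β →
      HankelTransition.MomentDeterminate (Set.Ici 0) (HankelTransition.moment β) ∧
      HankelTransition.MomentDeterminate Set.univ (HankelTransition.moment β) ∧
      Filter.Tendsto (fun N : ℕ => HankelTransition.smallestEigenvalue β N)
        Filter.atTop (nhds 0) ∧
      HankelTransition.IsSmallestEigenvalueInfinite β 0 ∧
      ¬ Summable (fun j : ℕ => HankelTransition.circleKernel β j j)) ∧
    (∀ β : ℝ, 0 < β → β < 1 / 2 →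
      HankelTransition.MomentIndeterminate (Set.Ici 0) (HankelTransition.moment β) ∧
      HankelTransition.MomentIndeterminate Set.univ (HankelTransition.moment β) ∧
      (∀ z : ℂ, Summable fun j : ℕ => ‖HankelTransition.orthonormalEval β j z‖ ^ 2) ∧
      TendstoLocallyUniformly
        (fun (n : ℕ) (z : ℂ) =>
          ∑ j ∈ Finset.range n, ‖HankelTransition.orthonormalEval β j z‖ ^ 2)
        (fun z : ℂ => ∑' j : ℕ, ‖HankelTransition.orthonormalEval β j z‖ ^ 2)
        Filter.atTop ∧
      ∃ ξ : ℝ, 0 < ξ ∧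
        HasSum (fun j : ℕ => HankelTransition.circleKernel β j j) (ξ : ℂ) ∧
        (∀ N : ℕ, 2 * Real.pi / ξ ≤ HankelTransition.smallestEigenvalue β N) ∧
        ∃ m : ℝ, HankelTransition.IsSmallestEigenvalueInfinite β m ∧
          Filter.Tendsto (fun N : ℕ => HankelTransition.smallestEigenvalue β N)
            Filter.atTop (nhds m) ∧
          2 * Real.pi / ξ ≤ m) := by
  constructor
  · intro β hβ
    have hβ0 : 0 < β := by linarith
    have hlim := tendsto_smallestEigenvalue hβ0
    have hinf := isSmallestEigenvalueInfinite_iInf hβ0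
    rw [iInf_smallestEigenvalue_eq_zero hβ] at hlim hinf
    exact ⟨momentDeterminate hβ subset_rfl, momentDeterminate hβ (Set.subset_univ _), hlim, hinf,
      not_summable_circleKernel hβ⟩
  · intro β hβ hβ'
    have hs := summable_coeffNormSq hβ hβ'
    have hle := two_pi_div_tsum_le_smallestEigenvalue hβ hs
    refine ⟨momentIndeterminate_Ici hβ hβ', momentIndeterminate_univ hβ hβ',
      summable_sq_norm_orthonormalEval hβ hβ', tendstoLocallyUniformly_sum_orthonormalEval hβ hβ',
      2 * Real.pi * ∑' j, coeffNormSq (orthonormalPoly β j), ?_, ?_, hle, _,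
      isSmallestEigenvalueInfinite_iInf hβ, tendsto_smallestEigenvalue hβ, le_ciInf hle⟩
    · have hpos := hs.tsum_pos (fun j => coeffNormSq_nonneg _) 0
        (coeffNormSq_pos (orthonormalPoly_ne_zero hβ 0))
      have := Real.pi_pos
      positivity
    · simp only [circleKernel_self, Complex.hasSum_ofReal]
      exact hs.hasSum.mul_left _
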